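/- Let $K=[0,1]^2$. For a closed set $S\subset K$ let $\mathcal M(S)$ be the space of bounded signed Borel measures on $\mathbb R^2$ supported in $S$, with the total-variation norm $\|\cdot\|_{\mathcal M}$. Write $\partial_1,\partial_2$ for the distributional partial derivatives on $\mathbb R^2$. Let $\mathcal M^+(K)$ be the cone of all real distributions $f\in\mathcal D'(\mathbb R^2)$ such that $\partial_1\partial_2 f\in\mathcal M(K)$, $\langle f,\varphi\rangle=0$ for every $\varphi\in C_c^\infty(\mathbb R^2\setminus K)$, and $\langle f,\varphi\rangle\ge 0$ for every $\varphi\in C_c^\infty(\mathbb R^2)$ with $\varphi\ge 0$; all such $f$ are integrable functions, and $\partial_1 f,\partial_2 f\in\mathcal M(K)$. For $n\ge 0$ let $\mathcal X_n=\{(i2^{-n},j2^{-n}) : i,j\in\{0,1,\dots,2^n\}\}$ and let $\mathcal M^+(\mathcal X_n)$ be the set of all $f\in\mathcal M^+(K)$ with $\partial_1\partial_2 f\in\mathcal M(\mathcal X_n)$. Fix an integer $N\ge 0$, data $y\in\mathbb R^{2^N\times 2^N}$, $\lambda\ge 0$ and $\theta\in(0,1]$, and define, for $f\in\mathcal M^+(K)$,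 $$\mathcal J(f)=\sum_{n_1,n_2=1}^{2^N}\Bigl(y_{n_1,n_2}-\int_{E_{n_1,n_2}} f(x)\,dx\Bigr)^2+\lambda\Bigl(\theta\,\|\partial_1\partial_2 f\|_{\mathcal M}+(1-\theta)\bigl(\|\partial_2 f\|_{\mathcal M}+\|\partial_1 f\|_{\mathcal M}\bigr)\Bigr),$$ where $E_{n_1,n_2}=\bigl[\tfrac{n_1-1}{2^N},\tfrac{n_1}{2^N}\bigr]\times\bigl[\tfrac{n_2-1}{2^N},\tfrac{n_2}{2^N}\bigr]$. Let $$\mathcal V=\operatorname*{argmin}_{f\in\mathcal M^+(K)}\mathcal J(f),\qquad \mathcal V_n=\operatorname*{argmin}_{f\in\mathcal M^+(\mathcal X_n)}\mathcal J(f).$$ Then, for all integers $N_2\ge N_1\ge N$, $$\mathcal V_{N_1}\subseteq\mathcal V_{N_2}\subseteq\mathcal V.$$ -/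

import Mathlib

open MeasureTheory TopologicalSpace
open scoped ENNReal LineDeriv

namespace MixedTV

noncomputable section

/-- Real test functions on the plane, i.e. smooth functions with compact support. -/
abbrev Test : Type := TestFunction (⊤ : Opens (ℝ × ℝ)) ℝ ⊤

/-- Real distributions on the plane. -/
abbrev Dist : Type := Distribution (⊤ : Opens (ℝ × ℝ)) ℝ ⊤

/-- The unit square `[0,1]²`. -/
def unitSquare : Set (ℝ × ℝ) := Set.Icc 0 1 ×ˢ Set.Icc 0 1

/-- The distributional derivative `D ⊗ I`. -/
def dX (f : Dist) : Dist := ∂_{((1, 0) : ℝ × ℝ)} f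

/-- The distributional derivative `I ⊗ D`. -/
def dY (f : Dist) : Dist := ∂_{((0, 1) : ℝ × ℝ)} f

/-- The mixed distributional derivative `D ⊗ D`. -/
def dXY (f : Dist) : Dist := dX (dY f)

/-- The distribution `T` is the bounded signed Borel measure `m`. -/
def IsMeasure (T : Dist) (m : SignedMeasure (ℝ × ℝ)) : Prop :=
  ∀ φ : Test, T φ = (∫ x, φ x ∂m.toJordanDecomposition.posPart)
    - ∫ x, φ x ∂m.toJordanDecomposition.negPart

/-- The bounded measure `m` is carried by `S`. -/
def CarriedBy (m : SignedMeasure (ℝ × ℝ)) (S : Set (ℝ × ℝ)) : Prop :=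
  m.totalVariation Sᶜ = 0

/-- The distribution `T` belongs to the space of bounded measures supported in `S`. -/
def MemMeasures (S : Set (ℝ × ℝ)) (T : Dist) : Prop :=
  ∃ m : SignedMeasure (ℝ × ℝ), IsMeasure T m ∧ CarriedBy m S

/-- The total-variation norm, over the unit square, of a distribution. It is the total mass
of `|m|` if `T` is a bounded measure `m` supported in the unit square (there is at most one such
`m`), and `∞` if there is no such measure. -/
def measureNorm (T : Dist) : ℝ≥0∞ :=
  ⨅ (m : SignedMeasure (ℝ × ℝ)) (_ : IsMeasure T m ∧ CarriedBy m unitSquare),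
    m.totalVariation Set.univ

/-- The native space: distributions that vanish off the unit square and whose mixed derivative
is a bounded measure supported in the unit square. -/
def nativeSpace : Set Dist :=
  {f | MemMeasures unitSquare (dXY f) ∧
    ∀ φ : Test, tsupport φ ⊆ unitSquareᶜ → f φ = 0}

/-- The cone of nonnegative elements of the native space. -/
def nativeCone : Set Dist :=
  {f | f ∈ nativeSpace ∧ ∀ φ : Test, (∀ x, 0 ≤ φ x) → 0 ≤ f φ}

/-- The dyadic grid of step `2⁻ⁿ` in the unit square, with `(2ⁿ + 1)²` knots. -/
def grid (n : ℕ) : Set (ℝ × ℝ) :=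
  {x | ∃ i j : ℕ, i ≤ 2 ^ n ∧ j ≤ 2 ^ n ∧ x = ((i : ℝ) / 2 ^ n, (j : ℝ) / 2 ^ n)}

/-- The elements of the cone whose mixed derivative is a measure supported on the grid. -/
def gridCone (n : ℕ) : Set Dist :=
  {f | f ∈ nativeCone ∧ MemMeasures (grid n) (dXY f)}

/-- The mixed norm `θ ‖(D ⊗ D) f‖ + (1 - θ) (‖(I ⊗ D) f‖ + ‖(D ⊗ I) f‖)`. -/
def mixedNorm (θ : ℝ) (f : Dist) : ℝ≥0∞ :=
  ENNReal.ofReal θ * measureNorm (dXY f)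
    + ENNReal.ofReal (1 - θ) * (measureNorm (dY f) + measureNorm (dX f))

/-- The distribution `f` is the locally integrable function `F`. -/
def IsFunction (f : Dist) (F : ℝ × ℝ → ℝ) : Prop :=
  LocallyIntegrable F volume ∧ ∀ φ : Test, f φ = ∫ x, F x * φ x

open Classical in
/-- The integral `∫_E f(x) dx` of a distribution that is a locally integrable function (this
function is unique almost everywhere); `0` for other distributions, among which there is no
element of the native space. -/
def integralOver (E : Set (ℝ × ℝ)) (f : Dist) : ℝ :=
  if h : ∃ F, IsFunction f F then ∫ x in E, h.choose x else 0

/-- The pixels at resolution `N`, indexed from `0`. -/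
def pixel (N : ℕ) (i j : Fin (2 ^ N)) : Set (ℝ × ℝ) :=
  Set.Icc ((i : ℝ) / 2 ^ N) (((i : ℝ) + 1) / 2 ^ N) ×ˢ
    Set.Icc ((j : ℝ) / 2 ^ N) (((j : ℝ) + 1) / 2 ^ N)

/-- The measurements: integrals over the pixels at resolution `N`. -/
def measurement (N : ℕ) (f : Dist) : Matrix (Fin (2 ^ N)) (Fin (2 ^ N)) ℝ :=
  fun i j => integralOver (pixel N i j) f

/-- The denoising loss `‖y - ν f‖₂² + lam ‖f‖_θ`. -/
def loss (N : ℕ) (y : Matrix (Fin (2 ^ N)) (Fin (2 ^ N)) ℝ) (lam θ : ℝ) (f : Dist) : ℝ≥0∞ :=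
  ENNReal.ofReal (∑ i, ∑ j, (y i j - measurement N f i j) ^ 2)
    + ENNReal.ofReal lam * mixedNorm θ f

/-- The minimizers of `J` over `S`. -/
def argmin (J : Dist → ℝ≥0∞) (S : Set Dist) : Set Dist :=
  {f | f ∈ S ∧ ∀ g ∈ S, J f ≤ J g}

/-- The solutions of the continuous-domain problem. -/
def solutions (N : ℕ) (y : Matrix (Fin (2 ^ N)) (Fin (2 ^ N)) ℝ) (lam θ : ℝ) : Set Dist :=
  argmin (loss N y lam θ) nativeCone

/-- The solutions of the problem discretized on the dyadic grid of step `2⁻ⁿ`. -/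
def gridSolutions (N : ℕ) (y : Matrix (Fin (2 ^ N)) (Fin (2 ^ N)) ℝ) (lam θ : ℝ) (n : ℕ) :
    Set Dist :=
  argmin (loss N y lam θ) (gridCone n)

end

end MixedTV

namespace MixedTV

noncomputable section

section SignedMeasures

variable {X : Type*} [MeasurableSpace X]

lemma integral_jordan_sub (μ ν : Measure X) [IsFiniteMeasure μ] [IsFiniteMeasure ν] {φ : X → ℝ}
    (hμ : Integrable φ μ) (hν : Integrable φ ν)
    (hp : Integrable φ (μ.toSignedMeasure - ν.toSignedMeasure).toJordanDecomposition.posPart)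
    (hn : Integrable φ (μ.toSignedMeasure - ν.toSignedMeasure).toJordanDecomposition.negPart) :
    (∫ x, φ x ∂(μ.toSignedMeasure - ν.toSignedMeasure).toJordanDecomposition.posPart)
      - ∫ x, φ x ∂(μ.toSignedMeasure - ν.toSignedMeasure).toJordanDecomposition.negPart
      = (∫ x, φ x ∂μ) - ∫ x, φ x ∂ν := by
  set m := μ.toSignedMeasure - ν.toSignedMeasure with hm
  have h := m.toSignedMeasure_toJordanDecomposition
  rw [JordanDecomposition.toSignedMeasure, hm, sub_eq_sub_iff_add_eq_add, ← hm] at h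
  have h2 : m.toJordanDecomposition.posPart + ν = μ + m.toJordanDecomposition.negPart := by
    rw [← Measure.toSignedMeasure_eq_toSignedMeasure_iff, Measure.toSignedMeasure_add,
      Measure.toSignedMeasure_add]
    exact h
  have h3 := congrArg (fun κ => ∫ x, φ x ∂κ) h2
  simp only [integral_add_measure hp hν, integral_add_measure hμ hn] at h3
  linarith

lemma totalVariation_sub_le (μ ν : Measure X) [IsFiniteMeasure μ] [IsFiniteMeasure ν] :
    (μ.toSignedMeasure - ν.toSignedMeasure).totalVariation ≤ μ + ν := by
  rw [SignedMeasure.totalVariation_eq_variation]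
  refine (VectorMeasure.variation_sub_le).trans ?_
  rw [Measure.variation_toSignedMeasure, Measure.variation_toSignedMeasure]

/-- A finite real combination of finite measures is a signed measure, whose total variation is
at most the combination with the absolute values of the coefficients. -/
lemma exists_signedMeasure_sum {ι : Type*} (s : Finset ι) (c : ι → ℝ) (ρ : ι → Measure X)
    [∀ i, IsFiniteMeasure (ρ i)] :
    ∃ m : SignedMeasure X,
      (∀ φ : X → ℝ, (∀ κ : Measure X, IsFiniteMeasure κ → Integrable φ κ) →
        (∫ x, φ x ∂m.toJordanDecomposition.posPart) - ∫ x, φ x ∂m.toJordanDecomposition.negPart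
          = ∑ i ∈ s, c i * ∫ x, φ x ∂(ρ i)) ∧
      ∀ E, m.totalVariation E ≤ ∑ i ∈ s, ENNReal.ofReal |c i| * ρ i E := by
  set μ : Measure X := ∑ i ∈ s, (c i).toNNReal • ρ i with hμ
  set ν : Measure X := ∑ i ∈ s, (-c i).toNNReal • ρ i with hν
  refine ⟨μ.toSignedMeasure - ν.toSignedMeasure, fun φ hφ => ?_, fun E => ?_⟩
  · rw [integral_jordan_sub μ ν (hφ _ inferInstance) (hφ _ inferInstance) (hφ _ inferInstance)
      (hφ _ inferInstance), hμ, hν, integral_finsetSum_measure, integral_finsetSum_measure,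
      ← Finset.sum_sub_distrib]
    · refine Finset.sum_congr rfl fun i _ => ?_
      rw [integral_smul_nnreal_measure, integral_smul_nnreal_measure, NNReal.smul_def,
        NNReal.smul_def, smul_eq_mul, smul_eq_mul, ← sub_mul, Real.coe_toNNReal',
        Real.coe_toNNReal']
      congr 1
      exact max_zero_sub_max_neg_zero_eq_self _
    · exact fun i _ => hφ _ inferInstance
    · exact fun i _ => hφ _ inferInstance
  · refine (totalVariation_sub_le μ ν E).trans (le_of_eq ?_)
    rw [Measure.add_apply, hμ, hν, Measure.finsetSum_apply, Measure.finsetSum_apply,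
      ← Finset.sum_add_distrib]
    refine Finset.sum_congr rfl fun i _ => ?_
    rw [Measure.smul_apply, Measure.smul_apply, ENNReal.smul_def, ENNReal.smul_def, smul_eq_mul,
      smul_eq_mul, ← add_mul]
    congr 1
    change ENNReal.ofReal _ + ENNReal.ofReal _ = _
    rcases le_total 0 (c i) with h | h
    · rw [ENNReal.ofReal_of_nonpos (neg_nonpos.2 h), add_zero, abs_of_nonneg h]
    · rw [ENNReal.ofReal_of_nonpos h, zero_add, abs_of_nonpos h]

/-- Pairing a difference of measures with the members of a subpartition of unity does not
increase the mass. -/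
lemma sum_abs_integral_sub_le {ι : Type*} (s : Finset ι) (w : ι → X → ℝ) (μ ν : Measure X)
    [IsFiniteMeasure μ] [IsFiniteMeasure ν] (hw : ∀ i x, 0 ≤ w i x)
    (hm : ∀ i, Measurable (w i)) {C : ℝ} (hC : ∀ x, ∑ i ∈ s, w i x ≤ C) :
    ∑ i ∈ s, ENNReal.ofReal |(∫ x, w i x ∂μ) - ∫ x, w i x ∂ν|
      ≤ ENNReal.ofReal C * (μ + ν) Set.univ := by
  have key : ∀ κ : Measure X, ∑ i ∈ s, ∫⁻ x, ENNReal.ofReal (w i x) ∂κ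
      ≤ ENNReal.ofReal C * κ Set.univ := fun κ => by
    rw [← lintegral_finsetSum _ fun i _ => (hm i).ennreal_ofReal, ← lintegral_const]
    refine lintegral_mono fun x => ?_
    rw [← ENNReal.ofReal_sum_of_nonneg fun i _ => hw i x]
    exact ENNReal.ofReal_le_ofReal (hC x)
  have one : ∀ (κ : Measure X) i, ENNReal.ofReal (∫ x, w i x ∂κ)
      ≤ ∫⁻ x, ENNReal.ofReal (w i x) ∂κ := fun κ i => by
    rw [integral_eq_lintegral_of_nonneg_ae (ae_of_all _ (hw i)) (hm i).aestronglyMeasurable]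
    exact ENNReal.ofReal_toReal_le
  calc ∑ i ∈ s, ENNReal.ofReal |(∫ x, w i x ∂μ) - ∫ x, w i x ∂ν|
      ≤ ∑ i ∈ s, ((∫⁻ x, ENNReal.ofReal (w i x) ∂μ) + ∫⁻ x, ENNReal.ofReal (w i x) ∂ν) := by
        refine Finset.sum_le_sum fun i _ => ?_
        have h1 : 0 ≤ ∫ x, w i x ∂μ := integral_nonneg (hw i)
        have h2 : 0 ≤ ∫ x, w i x ∂ν := integral_nonneg (hw i)
        refine le_trans (ENNReal.ofReal_le_ofReal (q := (∫ x, w i x ∂μ) + ∫ x, w i x ∂ν) ?_) ?_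
        · rw [abs_le]; constructor <;> linarith
        · rw [ENNReal.ofReal_add h1 h2]
          exact add_le_add (one _ _) (one _ _)
    _ ≤ _ := by
        rw [Finset.sum_add_distrib, Measure.add_apply, mul_add]
        exact add_le_add (key _) (key _)

end SignedMeasures

section Averages

open intervalIntegral

variable {E : Type*} [NormedAddCommGroup E] [NormedSpace ℝ E]

lemma contDiff_lineIntegral [FiniteDimensional ℝ E] [MeasurableSpace E] [BorelSpace E] {φ : E → ℝ}
    (hφ : ContDiff ℝ (⊤ : ℕ∞) φ) (hc : HasCompactSupport φ) (v : E) {L : ℝ} (hL : 0 ≤ L) :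
    ContDiff ℝ (⊤ : ℕ∞) fun x => ∫ s in 0..L, φ (x + s • v) := by
  set μ : Measure E := (volume.restrict (Set.Ioc 0 L)).map fun s : ℝ => -(s • v) with hμ
  have hmeas : Measurable fun s : ℝ => -(s • v) := by fun_prop
  have : IsFiniteMeasure μ := by rw [hμ]; infer_instance
  have h := hc.contDiff_convolution_right (μ := μ) (f := fun _ => (1 : ℝ))
    (ContinuousLinearMap.lsmul ℝ ℝ) (locallyIntegrable_const 1) hφ
  convert h using 2 with x
  rw [convolution_def, hμ, integral_map hmeas.aemeasurable]
  · rw [integral_of_le hL]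
    simp
  · have := hφ.continuous
    exact Continuous.aestronglyMeasurable (by simp; fun_prop)

lemma lineDeriv_lineIntegral {φ : E → ℝ} (hφ : Continuous φ) (v x : E) (L : ℝ) :
    HasLineDerivAt ℝ (fun x => ∫ s in 0..L, φ (x + s • v)) (φ (x + L • v) - φ x) x v := by
  have hc : Continuous fun s : ℝ => φ (x + s • v) := by fun_prop
  have h1 : ∀ t : ℝ, ∫ s in 0..L, φ (x + t • v + s • v)
      = (∫ s in 0..(t + L), φ (x + s • v)) - ∫ s in 0..t, φ (x + s • v) := fun t => by
    rw [integral_interval_sub_left (hc.intervalIntegrable _ _) (hc.intervalIntegrable _ _)]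
    have := integral_comp_add_left (fun s => φ (x + s • v)) (a := 0) (b := L) t
    rw [add_zero] at this
    rw [← this]
    refine integral_congr fun s _ => ?_
    simp only [add_smul, add_assoc]
  have h2 : ∀ t : ℝ, HasDerivAt (fun t => ∫ s in 0..t, φ (x + s • v)) (φ (x + t • v)) t :=
    fun t => integral_hasDerivAt_right (hc.intervalIntegrable _ _)
      (hc.stronglyMeasurableAtFilter _ _) hc.continuousAt
  have h3 := ((h2 (0 + L)).comp_add_const 0 L).fun_sub (h2 0)
  rw [HasLineDerivAt]
  simp only [h1]
  simpa using h3

lemma hasCompactSupport_lineIntegral {φ : E → ℝ} (hc : HasCompactSupport φ) (v : E) (L : ℝ) :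
    HasCompactSupport fun x => ∫ s in 0..L, φ (x + s • v) := by
  have hK : IsCompact ((fun p : E × ℝ => p.1 - p.2 • v) '' (tsupport φ ×ˢ Set.uIcc 0 L)) :=
    (IsCompact.prod hc isCompact_uIcc).image (by fun_prop)
  refine HasCompactSupport.intro hK fun x hx => ?_
  suffices h : Set.EqOn (fun s => φ (x + s • v)) (fun _ => 0) (Set.uIcc 0 L) by
    rw [intervalIntegral.integral_congr h, intervalIntegral.integral_zero]
  intro s hs
  by_contra hne
  exact hx ⟨(x + s • v, s), ⟨subset_tsupport _ hne, hs⟩, by simp⟩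

end Averages

section TestFunctions

/-- A smooth compactly supported function on the plane, as a test function. -/
def mkTest (φ : ℝ × ℝ → ℝ) (h : ContDiff ℝ (⊤ : ℕ∞) φ) (hc : HasCompactSupport φ) : Test :=
  ⟨φ, h, hc, fun _ _ => trivial⟩

@[simp]
lemma mkTest_apply (φ : ℝ × ℝ → ℝ) (h : ContDiff ℝ (⊤ : ℕ∞) φ) (hc : HasCompactSupport φ)
    (z : ℝ × ℝ) : mkTest φ h hc z = φ z := rfl

lemma lineDerivOp_test_apply (φ : Test) (v z : ℝ × ℝ) : (∂_{v} φ) z = lineDeriv ℝ φ z v :=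
  TestFunction.lineDerivCLM_apply_of_le (𝕜 := ℝ) le_rfl

lemma dX_apply (f : Dist) (φ : Test) : dX f φ = -f (∂_{((1, 0) : ℝ × ℝ)} φ) := by
  rw [dX, Distribution.lineDerivOp_apply_apply, map_neg]

lemma dY_apply (f : Dist) (φ : Test) : dY f φ = -f (∂_{((0, 1) : ℝ × ℝ)} φ) := by
  rw [dY, Distribution.lineDerivOp_apply_apply, map_neg]

lemma dXY_apply (f : Dist) (φ : Test) :
    dXY f φ = f (∂_{((0, 1) : ℝ × ℝ)} (∂_{((1, 0) : ℝ × ℝ)} φ)) := by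
  rw [dXY, dX_apply, dY_apply, neg_neg]

/-- The translate `z ↦ φ (z + a)`. -/
def translate (φ : Test) (a : ℝ × ℝ) : Test :=
  mkTest (fun z => φ (z + a)) (φ.contDiff.comp (contDiff_id.add contDiff_const))
    (φ.hasCompactSupport.comp_homeomorph (Homeomorph.addRight a))

@[simp]
lemma translate_apply (φ : Test) (a z : ℝ × ℝ) : translate φ a z = φ (z + a) := rfl

lemma tsupport_translate_subset (φ : Test) (a : ℝ × ℝ) :
    tsupport (translate φ a) ⊆ (fun z => z + a) ⁻¹' tsupport φ :=
  tsupport_comp_subset_preimage φ (by fun_prop)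

/-- The integral of a test function over the segments `[z, z + L v]`. -/
def segInt (φ : Test) (v : ℝ × ℝ) (L : ℝ) (hL : 0 ≤ L) : Test :=
  mkTest (fun z => ∫ s in 0..L, φ (z + s • v))
    (contDiff_lineIntegral φ.contDiff φ.hasCompactSupport v hL)
    (hasCompactSupport_lineIntegral φ.hasCompactSupport v L)

lemma segInt_apply (φ : Test) (v : ℝ × ℝ) (L : ℝ) (hL : 0 ≤ L) (z : ℝ × ℝ) :
    segInt φ v L hL z = ∫ s in 0..L, φ (z + s • v) := rfl

lemma lineDerivOp_segInt (φ : Test) (v : ℝ × ℝ) (L : ℝ) (hL : 0 ≤ L) :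
    ∂_{v} (segInt φ v L hL) = translate φ (L • v) - φ := by
  ext z
  rw [lineDerivOp_test_apply]
  exact (lineDeriv_lineIntegral φ.continuous v z L).lineDeriv

lemma translate_segInt (φ : Test) (v a : ℝ × ℝ) (L : ℝ) (hL : 0 ≤ L) :
    translate (segInt φ v L hL) a = segInt (translate φ a) v L hL := by
  ext z
  simp only [translate_apply, segInt_apply]
  refine intervalIntegral.integral_congr fun s _ => ?_
  simp only [add_right_comm]

lemma mixedDeriv_segInt (φ : Test) (v w : ℝ × ℝ) (L : ℝ) (hL : 0 ≤ L) :
    ∂_{w} (∂_{v} (segInt (segInt φ w L hL) v L hL))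
      = translate (translate φ (L • v)) (L • w) - translate φ (L • v)
        - (translate φ (L • w) - φ) := by
  have hsub : ∀ φ ψ : Test, ∂_{w} (φ - ψ) = ∂_{w} φ - ∂_{w} ψ :=
    map_sub (TestFunction.lineDerivCLM (n := ⊤) (k := ⊤) ℝ w)
  rw [lineDerivOp_segInt, translate_segInt, hsub, lineDerivOp_segInt, lineDerivOp_segInt]

end TestFunctions

section Representation

lemma integrable_test (φ : Test) (μ : Measure (ℝ × ℝ)) [IsFiniteMeasureOnCompacts μ] :
    Integrable φ μ := φ.continuous.integrable_of_hasCompactSupport φ.hasCompactSupport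

/-- For large `L`, integrating a mixed derivative against the double segment integral of `φ`
recovers the pairing with `φ`. -/
lemma apply_eq_dXY_segInt {f : Dist}
    (hf : ∀ φ : Test, tsupport φ ⊆ unitSquareᶜ → f φ = 0) (φ : Test) {L : ℝ} (hL : 0 ≤ L)
    (hsupp : ∀ z ∈ tsupport φ, z.1 < L ∧ z.2 < L) :
    f φ = dXY f (segInt (segInt φ (0, 1) L hL) (1, 0) L hL) := by
  have off : ∀ a : ℝ × ℝ, (L ≤ a.1 ∨ L ≤ a.2) → f (translate φ a) = 0 := fun a ha => by
    refine hf _ fun z hz hK => ?_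
    have h1 := hsupp _ (tsupport_translate_subset φ a hz)
    obtain ⟨⟨h2, -⟩, ⟨h3, -⟩⟩ := hK
    simp only [Prod.fst_add, Prod.snd_add] at h1
    rcases ha with h | h <;> linarith [h1.1, h1.2]
  have tt : translate (translate φ (L • ((1, 0) : ℝ × ℝ))) (L • ((0, 1) : ℝ × ℝ))
      = translate φ (L, L) := by
    ext z
    simp [add_assoc]
  rw [dXY_apply, mixedDeriv_segInt, tt, map_sub, map_sub, map_sub, off _ (by simp),
    off _ (by simp), off _ (by simp)]
  ring

lemma setIntegral_Ioi_prod_eq_segInt (φ : Test) {L : ℝ} (hL : 0 ≤ L)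
    (hsupp : ∀ z ∈ tsupport φ, z.1 < L ∧ z.2 < L) {w : ℝ × ℝ} (hw : w ∈ unitSquare) :
    ∫ z in Set.Ioi w.1 ×ˢ Set.Ioi w.2, φ z
      = segInt (segInt φ (0, 1) L hL) (1, 0) L hL w := by
  have h1 : ∫ z in Set.Ioi w.1 ×ˢ Set.Ioi w.2, φ z
      = ∫ z in Set.Ioc w.1 (w.1 + L) ×ˢ Set.Ioc w.2 (w.2 + L), φ z := by
    refine setIntegral_eq_of_subset_of_forall_sdiff_eq_zero
      (measurableSet_Ioi.prod measurableSet_Ioi)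
      (Set.prod_mono Set.Ioc_subset_Ioi_self Set.Ioc_subset_Ioi_self) fun z hz => ?_
    by_contra hne
    have h2 := hsupp z (subset_tsupport _ hne)
    obtain ⟨⟨h3, -⟩, ⟨h4, -⟩⟩ := hw
    exact hz.2 ⟨⟨hz.1.1, by linarith [h2.1]⟩, ⟨hz.1.2, by linarith [h2.2]⟩⟩
  rw [h1, Measure.volume_eq_prod, setIntegral_prod _ (integrable_test φ _).integrableOn,
    ← intervalIntegral.integral_of_le (by linarith), segInt_apply]
  have h5 := intervalIntegral.integral_comp_add_left
    (fun x => ∫ y in Set.Ioc w.2 (w.2 + L), φ (x, y)) (a := 0) (b := L) w.1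
  rw [add_zero] at h5
  rw [← h5]
  refine intervalIntegral.integral_congr fun s _ => ?_
  simp only [segInt_apply]
  rw [← intervalIntegral.integral_of_le (by linarith)]
  have h6 := intervalIntegral.integral_comp_add_left
    (fun y => φ (w.1 + s, y)) (a := 0) (b := L) w.2
  rw [add_zero] at h6
  rw [← h6]
  refine intervalIntegral.integral_congr fun t _ => ?_
  congr 1
  ext <;> simp

/-- The distribution function of a measure on the plane. -/
def cumul (μ : Measure (ℝ × ℝ)) (z : ℝ × ℝ) : ℝ := μ.real (Set.Iio z.1 ×ˢ Set.Iio z.2)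

lemma measurableSet_quadrant :
    MeasurableSet {p : (ℝ × ℝ) × (ℝ × ℝ) | p.2.1 < p.1.1 ∧ p.2.2 < p.1.2} :=
  ((isOpen_lt (by fun_prop) (by fun_prop)).and
    (isOpen_lt (by fun_prop) (by fun_prop))).measurableSet

lemma measurable_cumul (μ : Measure (ℝ × ℝ)) [IsFiniteMeasure μ] : Measurable (cumul μ) :=
  (measurable_measure_prodMk_left (ν := μ) measurableSet_quadrant).ennreal_toReal

lemma locallyIntegrable_cumul (μ : Measure (ℝ × ℝ)) [IsFiniteMeasure μ] :
    LocallyIntegrable (cumul μ) volume := by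
  refine (locallyIntegrable_const (μ.real Set.univ)).mono
    (measurable_cumul μ).aestronglyMeasurable (ae_of_all _ fun z => ?_)
  rw [cumul, Real.norm_of_nonneg measureReal_nonneg, Real.norm_of_nonneg measureReal_nonneg]
  exact measureReal_mono (Set.subset_univ _)

lemma integral_cumul_mul (μ : Measure (ℝ × ℝ)) [IsFiniteMeasure μ] (φ : Test) :
    ∫ z, cumul μ z * φ z = ∫ w, (∫ z in Set.Ioi w.1 ×ˢ Set.Ioi w.2, φ z) ∂μ := by
  set Q : Set ((ℝ × ℝ) × (ℝ × ℝ)) := {p | p.2.1 < p.1.1 ∧ p.2.2 < p.1.2} with hQ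
  have hint : Integrable (Q.indicator fun p => φ p.1) ((volume : Measure (ℝ × ℝ)).prod μ) :=
    ((integrable_test φ volume).comp_fst μ).indicator measurableSet_quadrant
  have hsw := integral_integral_swap (f := fun z w => Q.indicator (fun p => φ p.1) (z, w)) hint
  have hl : ∀ z, ∫ w, Q.indicator (fun p => φ p.1) (z, w) ∂μ = cumul μ z * φ z := fun z => by
    have : (fun w => Q.indicator (fun p => φ p.1) (z, w))
        = (Set.Iio z.1 ×ˢ Set.Iio z.2).indicator fun _ => φ z := by
      ext w
      by_cases h : w ∈ Set.Iio z.1 ×ˢ Set.Iio z.2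
      · rw [Set.indicator_of_mem h, Set.indicator_of_mem (show (z, w) ∈ Q from h)]
      · rw [Set.indicator_of_notMem h, Set.indicator_of_notMem (show (z, w) ∉ Q from h)]
    rw [this, integral_indicator_const _ (measurableSet_Iio.prod measurableSet_Iio)]
    rfl
  have hr : ∀ w, ∫ z, Q.indicator (fun p => φ p.1) (z, w)
      = ∫ z in Set.Ioi w.1 ×ˢ Set.Ioi w.2, φ z := fun w => by
    rw [← integral_indicator (measurableSet_Ioi.prod measurableSet_Ioi)]
    refine integral_congr_ae (ae_of_all _ fun z => ?_)
    by_cases h : z ∈ Set.Ioi w.1 ×ˢ Set.Ioi w.2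
    · exact (Set.indicator_of_mem (show (z, w) ∈ Q from h) _).trans
        (Set.indicator_of_mem h _).symm
    · exact (Set.indicator_of_notMem (show (z, w) ∉ Q from h) _).trans
        (Set.indicator_of_notMem h _).symm
  simp only [hl, hr] at hsw
  exact hsw

/-- Every element of the native space is a locally integrable function. -/
theorem exists_isFunction {f : Dist} (hf : f ∈ nativeSpace) : ∃ F, IsFunction f F := by
  obtain ⟨⟨m, hm, hmK⟩, hoff⟩ := hf
  set μ := m.toJordanDecomposition.posPart with hμ
  set ν := m.toJordanDecomposition.negPart with hν
  have hK : μ unitSquareᶜ = 0 ∧ ν unitSquareᶜ = 0 := by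
    rw [CarriedBy, SignedMeasure.totalVariation, Measure.add_apply, add_eq_zero] at hmK
    exact hmK
  refine ⟨fun z => cumul μ z - cumul ν z,
    (locallyIntegrable_cumul μ).sub (locallyIntegrable_cumul ν), fun φ => ?_⟩
  obtain ⟨R, hR⟩ := φ.hasCompactSupport.isBounded.subset_closedBall (0 : ℝ × ℝ)
  have hsupp : ∀ z ∈ tsupport φ, z.1 < |R| + 1 ∧ z.2 < |R| + 1 := fun z hz => by
    have h := hR hz
    rw [mem_closedBall_zero_iff, Prod.norm_def, max_le_iff, Real.norm_eq_abs,
      Real.norm_eq_abs] at h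
    constructor <;> linarith [le_abs_self z.1, le_abs_self z.2, le_abs_self R, h.1, h.2]
  have hL : 0 ≤ |R| + 1 := by positivity
  have key : ∀ κ : Measure (ℝ × ℝ), IsFiniteMeasure κ → κ unitSquareᶜ = 0 →
      ∫ w, segInt (segInt φ (0, 1) _ hL) (1, 0) _ hL w ∂κ = ∫ z, cumul κ z * φ z :=
    fun κ _ hκ => by
      rw [integral_cumul_mul]
      refine integral_congr_ae ?_
      filter_upwards [mem_ae_iff.2 hκ] with w hw
      exact (setIntegral_Ioi_prod_eq_segInt φ hL hsupp hw).symm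
  have hint : ∀ κ : Measure (ℝ × ℝ), IsFiniteMeasure κ →
      Integrable (fun z => cumul κ z * φ z) volume := fun κ _ => by
    have := (locallyIntegrable_cumul κ).integrable_smul_right_of_hasCompactSupport
      φ.continuous φ.hasCompactSupport
    exact this
  rw [apply_eq_dXY_segInt hoff φ hL hsupp, hm, key _ inferInstance hK.1,
    key _ inferInstance hK.2, ← integral_sub (hint _ inferInstance) (hint _ inferInstance)]
  simp only [sub_mul]

end Representation

section Approximation

open Filter Topology

/-- The backward difference of step `h`. -/
def bdiff (h : ℝ) (u : ℝ → ℝ) (x : ℝ) : ℝ := u x - u (x - h)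

/-- The integral over the window of length `h` to the left of a point. -/
def window (h : ℝ) (u : ℝ → ℝ) (x : ℝ) : ℝ := ∫ s in 0..h, u (x + s • (-1))

lemma hasDerivAt_window {u : ℝ → ℝ} (hu : Continuous u) (h x : ℝ) :
    HasDerivAt (window h u) (bdiff h u x) x := by
  have h1 : HasDerivAt (fun t : ℝ => window h u (x + t • (-1))) (u (x + h • (-1)) - u x) 0 :=
    lineDeriv_lineIntegral hu (-1) x h
  have h2 : HasDerivAt (fun y : ℝ => x - y) (-1) x := by
    simpa using (hasDerivAt_id x).const_sub x
  rw [← sub_self x] at h1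
  have h3 := h1.comp x h2
  have h4 : ((fun t : ℝ => window h u (x + t • (-1))) ∘ fun y : ℝ => x - y) = window h u := by
    ext y
    simp
  rw [h4] at h3
  have h5 : bdiff h u x = (u (x + h • (-1)) - u x) * (-1) := by simp [bdiff, sub_eq_add_neg]
  rw [h5]
  exact h3

/-- A bounded sequence of smooth functions with uniformly bounded supports that converges
pointwise. -/
structure SmoothApprox (u : ℕ → ℝ → ℝ) (U : ℝ → ℝ) : Prop where
  contDiff : ∀ j, ContDiff ℝ (⊤ : ℕ∞) (u j)
  supp : ∃ R : ℝ, ∀ j x, R < |x| → u j x = 0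
  bound : ∃ C : ℝ, ∀ j x, |u j x| ≤ C
  tendsto : ∀ x, Tendsto (fun j => u j x) atTop (𝓝 (U x))

namespace SmoothApprox

variable {u v : ℕ → ℝ → ℝ} {U V : ℝ → ℝ}

lemma hasCompactSupport (hu : SmoothApprox u U) (j : ℕ) : HasCompactSupport (u j) := by
  obtain ⟨R, hR⟩ := hu.supp
  refine HasCompactSupport.intro (isCompact_closedBall (0 : ℝ) R) fun x hx => hR j x ?_
  simpa using hx

lemma measurable (hu : SmoothApprox u U) : Measurable U :=
  measurable_of_tendsto_metrizable (fun j => (hu.contDiff j).continuous.measurable)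
    (tendsto_pi_nhds.2 hu.tendsto)

lemma bdiff (hu : SmoothApprox u U) (h : ℝ) :
    SmoothApprox (fun j => bdiff h (u j)) (bdiff h U) where
  contDiff j := (hu.contDiff j).sub ((hu.contDiff j).comp (contDiff_id.sub contDiff_const))
  supp := by
    obtain ⟨R, hR⟩ := hu.supp
    refine ⟨R + |h|, fun j x hx => ?_⟩
    have := abs_sub_abs_le_abs_sub x h
    rw [MixedTV.bdiff, hR j x (by linarith [abs_nonneg h]), hR j (x - h) (by linarith), sub_zero]
  bound := by
    obtain ⟨C, hC⟩ := hu.bound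
    refine ⟨C + C, fun j x => ?_⟩
    exact (abs_sub _ _).trans (add_le_add (hC _ _) (hC _ _))
  tendsto x := (hu.tendsto x).sub (hu.tendsto (x - h))

lemma window (hu : SmoothApprox u U) {h : ℝ} (hh : 0 ≤ h) :
    SmoothApprox (fun j => window h (u j)) (window h U) where
  contDiff j := contDiff_lineIntegral (hu.contDiff j) (hu.hasCompactSupport j) (-1) hh
  supp := by
    obtain ⟨R, hR⟩ := hu.supp
    refine ⟨R + h, fun j x hx => ?_⟩
    suffices H : Set.EqOn (fun s => u j (x + s • (-1))) (fun _ => 0) (Set.uIcc 0 h) by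
      rw [MixedTV.window, intervalIntegral.integral_congr H, intervalIntegral.integral_zero]
    intro s hs
    rw [Set.uIcc_of_le hh] at hs
    refine hR j _ ?_
    have := abs_sub_abs_le_abs_sub x s
    rw [abs_of_nonneg hs.1] at this
    rw [smul_eq_mul, mul_neg_one, ← sub_eq_add_neg]
    linarith [hs.2]
  bound := by
    obtain ⟨C, hC⟩ := hu.bound
    refine ⟨C * |h - 0|, fun j x => ?_⟩
    exact intervalIntegral.norm_integral_le_of_norm_le_const (f := fun s => u j (x + s • (-1)))
      fun s _ => hC _ _
  tendsto x := by
    obtain ⟨C, hC⟩ := hu.bound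
    refine intervalIntegral.tendsto_integral_filter_of_dominated_convergence (fun _ => C) ?_ ?_
      intervalIntegrable_const ?_
    · have := fun j => (hu.contDiff j).continuous
      exact Eventually.of_forall fun j => Continuous.aestronglyMeasurable (by fun_prop)
    · exact Eventually.of_forall fun j => ae_of_all _ fun s _ => hC _ _
    · exact ae_of_all _ fun s _ => hu.tendsto _

end SmoothApprox

/-- Indicators of half-open intervals are limits of smooth functions. -/
lemma exists_smoothApprox_indicator_Ico (a b : ℝ) :
    ∃ u, SmoothApprox u ((Set.Ico a b).indicator 1) ∧ ∀ j x, 0 ≤ u j x := by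
  have hle : ∀ x, 0 ≤ 1 - Real.smoothTransition x := fun x =>
    sub_nonneg.2 (Real.smoothTransition.le_one x)
  have lim : ∀ x c : ℝ, Tendsto (fun j : ℕ => Real.smoothTransition (j * (x - c) + 1)) atTop
      (𝓝 (if c ≤ x then 1 else 0)) := fun x c => by
    split_ifs with hc
    · refine tendsto_const_nhds.congr fun j => (Real.smoothTransition.one_of_one_le ?_).symm
      have : 0 ≤ (j : ℝ) * (x - c) := mul_nonneg j.cast_nonneg (sub_nonneg.2 hc)
      linarith
    · have hpos : 0 < c - x := by linarith
      have ht := (tendsto_natCast_atTop_atTop (R := ℝ)).eventually_ge_atTop (1 / (c - x))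
      refine tendsto_const_nhds.congr' (ht.mono fun j hj =>
        (Real.smoothTransition.zero_of_nonpos ?_).symm)
      rw [div_le_iff₀ hpos] at hj
      linarith
  refine ⟨fun j x => Real.smoothTransition (j * (x - a) + 1)
    * (1 - Real.smoothTransition (j * (x - b) + 1)), ⟨fun j => ?_, ?_, ⟨1, fun j x => ?_⟩,
    fun x => ?_⟩, fun j x => mul_nonneg (Real.smoothTransition.nonneg _) (hle _)⟩
  · have h1 : ∀ c : ℝ, ContDiff ℝ (⊤ : ℕ∞) fun x : ℝ => Real.smoothTransition (j * (x - c) + 1) :=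
      fun c => Real.smoothTransition.contDiff.comp
        ((contDiff_const.mul (contDiff_id.sub contDiff_const)).add contDiff_const)
    exact (h1 a).mul (contDiff_const.sub (h1 b))
  · refine ⟨|a| + |b| + 1, fun j x hx => ?_⟩
    rcases Nat.eq_zero_or_pos j with rfl | hj
    · simp
    have hj' : (1 : ℝ) ≤ j := by exact_mod_cast hj
    rcases le_total 0 x with h0 | h0
    · rw [abs_of_nonneg h0] at hx
      have : 0 ≤ (j : ℝ) * (x - b) := mul_nonneg j.cast_nonneg
        (by linarith [le_abs_self b, abs_nonneg a])
      rw [Real.smoothTransition.one_of_one_le (x := j * (x - b) + 1) (by linarith), sub_self,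
        mul_zero]
    · rw [abs_of_nonpos h0] at hx
      have : 1 * (a - x - 1) ≤ (j : ℝ) * (a - x - 1) := by
        refine mul_le_mul_of_nonneg_right hj' ?_
        linarith [neg_abs_le a, abs_nonneg b]
      rw [Real.smoothTransition.zero_of_nonpos, zero_mul]
      linarith [neg_abs_le a, abs_nonneg b]
  · rw [abs_of_nonneg (mul_nonneg (Real.smoothTransition.nonneg _) (hle _))]
    exact mul_le_one₀ (Real.smoothTransition.le_one _) (hle _)
      (by linarith [Real.smoothTransition.nonneg (j * (x - b) + 1)])
  · convert (lim x a).mul ((lim x b).const_sub 1) using 2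
    by_cases h1 : a ≤ x <;> by_cases h2 : b ≤ x <;>
      simp [Set.indicator, h1, h2, not_le.1, not_lt.2]

end Approximation

section Tensor

open Filter Topology

/-- The tensor product of two smooth compactly supported functions. -/
def tens (u v : ℝ → ℝ) (hu : ContDiff ℝ (⊤ : ℕ∞) u) (hv : ContDiff ℝ (⊤ : ℕ∞) v)
    (hcu : HasCompactSupport u) (hcv : HasCompactSupport v) : Test :=
  mkTest (fun z => u z.1 * v z.2) ((hu.comp contDiff_fst).mul (hv.comp contDiff_snd)) <| by
    refine HasCompactSupport.intro (IsCompact.prod hcu hcv) fun z hz => ?_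
    by_contra hne
    exact hz ⟨subset_tsupport _ (left_ne_zero_of_mul hne),
      subset_tsupport _ (right_ne_zero_of_mul hne)⟩

lemma lineDerivOp_tens_fst {u u' v : ℝ → ℝ} (hu hv hcu hcv) (hu' : ContDiff ℝ (⊤ : ℕ∞) u')
    (hcu' : HasCompactSupport u') (hd : ∀ x, HasDerivAt u (u' x) x) :
    ∂_{((1, 0) : ℝ × ℝ)} (tens u v hu hv hcu hcv) = tens u' v hu' hv hcu' hcv := by
  ext z
  rw [lineDerivOp_test_apply]
  refine HasLineDerivAt.lineDeriv ?_
  have h : HasDerivAt (fun t => u (z.1 + t) * v z.2) (u' z.1 * v z.2) 0 :=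
    ((show HasDerivAt u (u' z.1) (z.1 + 0) by simpa using hd z.1).comp_const_add z.1 0).mul_const _
  have e : (fun t : ℝ => tens u v hu hv hcu hcv (z + t • ((1, 0) : ℝ × ℝ)))
      = fun t => u (z.1 + t) * v z.2 := by
    ext t
    simp [tens]
  rw [HasLineDerivAt, e]
  exact h

lemma lineDerivOp_tens_snd {u v v' : ℝ → ℝ} (hu hv hcu hcv) (hv' : ContDiff ℝ (⊤ : ℕ∞) v')
    (hcv' : HasCompactSupport v') (hd : ∀ x, HasDerivAt v (v' x) x) :
    ∂_{((0, 1) : ℝ × ℝ)} (tens u v hu hv hcu hcv) = tens u v' hu hv' hcu hcv' := by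
  ext z
  rw [lineDerivOp_test_apply]
  refine HasLineDerivAt.lineDeriv ?_
  have h : HasDerivAt (fun t => u z.1 * v (z.2 + t)) (u z.1 * v' z.2) 0 :=
    ((show HasDerivAt v (v' z.2) (z.2 + 0) by simpa using hd z.2).comp_const_add z.2 0).const_mul _
  have e : (fun t : ℝ => tens u v hu hv hcu hcv (z + t • ((0, 1) : ℝ × ℝ)))
      = fun t => u z.1 * v (z.2 + t) := by
    ext t
    simp [tens]
  rw [HasLineDerivAt, e]
  exact h

variable {u v : ℕ → ℝ → ℝ} {U V : ℝ → ℝ}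

/-- The tensor products of two approximating sequences. -/
def SmoothApprox.tens (hu : SmoothApprox u U) (hv : SmoothApprox v V) (j : ℕ) : Test :=
  MixedTV.tens (u j) (v j) (hu.contDiff j) (hv.contDiff j) (hu.hasCompactSupport j)
    (hv.hasCompactSupport j)

lemma SmoothApprox.tens_apply (hu : SmoothApprox u U) (hv : SmoothApprox v V) (j : ℕ)
    (z : ℝ × ℝ) : hu.tens hv j z = u j z.1 * v j z.2 := rfl

lemma SmoothApprox.tendsto_integral_mul (hu : SmoothApprox u U) (hv : SmoothApprox v V)
    {μ : Measure (ℝ × ℝ)} {F : ℝ × ℝ → ℝ} (hF : LocallyIntegrable F μ) :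
    Tendsto (fun j => ∫ z, F z * hu.tens hv j z ∂μ) atTop
      (𝓝 (∫ z, F z * (U z.1 * V z.2) ∂μ)) := by
  obtain ⟨R, hR⟩ := hu.supp
  obtain ⟨R', hR'⟩ := hv.supp
  obtain ⟨C, hC⟩ := hu.bound
  obtain ⟨D, hD⟩ := hv.bound
  set B : Set (ℝ × ℝ) := Metric.closedBall 0 (max R R') with hB
  have hBm : MeasurableSet B := Metric.isClosed_closedBall.measurableSet
  have hFB : IntegrableOn F B μ := hF.integrableOn_isCompact (isCompact_closedBall _ _)
  have hzero : ∀ j z, z ∉ B → F z * hu.tens hv j z = 0 := fun j z hz => by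
    rw [hB, mem_closedBall_zero_iff, not_le, Prod.norm_def, Real.norm_eq_abs,
      Real.norm_eq_abs, lt_max_iff] at hz
    rw [SmoothApprox.tens_apply]
    rcases hz with h | h
    · rw [hR j _ ((le_max_left _ _).trans_lt h), zero_mul, mul_zero]
    · rw [hR' j _ ((le_max_right _ _).trans_lt h), mul_zero, mul_zero]
  refine tendsto_integral_of_dominated_convergence
    (B.indicator fun z => ‖F z‖ * (C * D)) (fun j => ?_) ?_ (fun j => ae_of_all _ fun z => ?_)
    (ae_of_all _ fun z => ?_)
  · have h1 : AEStronglyMeasurable (B.indicator fun z => F z * hu.tens hv j z) μ := by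
      rw [aestronglyMeasurable_indicator_iff hBm]
      exact hFB.aestronglyMeasurable.mul (hu.tens hv j).continuous.aestronglyMeasurable
    convert h1 using 1
    ext z
    by_cases hz : z ∈ B
    · rw [Set.indicator_of_mem hz]
    · rw [Set.indicator_of_notMem hz, hzero j z hz]
  · rw [integrable_indicator_iff hBm]
    exact hFB.norm.mul_const _
  · by_cases hz : z ∈ B
    · rw [Set.indicator_of_mem hz, norm_mul, SmoothApprox.tens_apply, norm_mul]
      gcongr
      · exact (abs_nonneg _).trans (hC 0 0)
      · exact hC _ _
      · exact hD _ _
    · rw [Set.indicator_of_notMem hz, hzero j z hz, norm_zero]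
  · exact ((hu.tendsto z.1).mul (hv.tendsto z.2)).const_mul _

lemma SmoothApprox.tendsto_integral (hu : SmoothApprox u U) (hv : SmoothApprox v V)
    (μ : Measure (ℝ × ℝ)) [IsFiniteMeasure μ] :
    Tendsto (fun j => ∫ z, hu.tens hv j z ∂μ) atTop (𝓝 (∫ z, U z.1 * V z.2 ∂μ)) := by
  simpa using hu.tendsto_integral_mul hv (μ := μ) (F := fun _ => 1) (locallyIntegrable_const 1)

lemma SmoothApprox.tendsto_isFunction (hu : SmoothApprox u U) (hv : SmoothApprox v V)
    {f : Dist} {F : ℝ × ℝ → ℝ} (hf : IsFunction f F) :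
    Tendsto (fun j => f (hu.tens hv j)) atTop (𝓝 (∫ z, F z * (U z.1 * V z.2))) := by
  simp only [hf.2]
  exact hu.tendsto_integral_mul hv hf.1

/-- The pairing of a signed measure with a function. -/
def pairing (m : SignedMeasure (ℝ × ℝ)) (w : ℝ × ℝ → ℝ) : ℝ :=
  (∫ z, w z ∂m.toJordanDecomposition.posPart) - ∫ z, w z ∂m.toJordanDecomposition.negPart

lemma SmoothApprox.tendsto_isMeasure (hu : SmoothApprox u U) (hv : SmoothApprox v V)
    {T : Dist} {m : SignedMeasure (ℝ × ℝ)} (hT : IsMeasure T m) :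
    Tendsto (fun j => T (hu.tens hv j)) atTop (𝓝 (pairing m fun z => U z.1 * V z.2)) := by
  simp only [hT (hu.tens hv _)]
  exact (hu.tendsto_integral hv _).sub (hu.tendsto_integral hv _)

lemma SmoothApprox.lineDerivOp_window_fst (hu : SmoothApprox u U) (hv : SmoothApprox v V)
    {h : ℝ} (hh : 0 ≤ h) (j : ℕ) :
    ∂_{((1, 0) : ℝ × ℝ)} ((hu.window hh).tens hv j) = (hu.bdiff h).tens hv j :=
  lineDerivOp_tens_fst _ _ _ _ _ _ (hasDerivAt_window (hu.contDiff j).continuous h)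

lemma SmoothApprox.lineDerivOp_window_snd (hu : SmoothApprox u U) (hv : SmoothApprox v V)
    {h : ℝ} (hh : 0 ≤ h) (j : ℕ) :
    ∂_{((0, 1) : ℝ × ℝ)} (hu.tens (hv.window hh) j) = hu.tens (hv.bdiff h) j :=
  lineDerivOp_tens_snd _ _ _ _ _ _ (hasDerivAt_window (hv.contDiff j).continuous h)

variable {f : Dist} {F : ℝ × ℝ → ℝ} {m : SignedMeasure (ℝ × ℝ)} {h : ℝ}

lemma SmoothApprox.integral_dXY (hu : SmoothApprox u U) (hv : SmoothApprox v V)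
    (hf : IsFunction f F) (hm : IsMeasure (dXY f) m) (hh : 0 ≤ h) :
    ∫ z, F z * (MixedTV.bdiff h U z.1 * MixedTV.bdiff h V z.2)
      = pairing m fun z => MixedTV.window h U z.1 * MixedTV.window h V z.2 := by
  refine tendsto_nhds_unique ((hu.bdiff h).tendsto_isFunction (hv.bdiff h) hf) ?_
  refine ((hu.window hh).tendsto_isMeasure (hv.window hh) hm).congr fun j => ?_
  rw [dXY_apply, hu.lineDerivOp_window_fst (hv.window hh) hh,
    (hu.bdiff h).lineDerivOp_window_snd hv hh]

lemma SmoothApprox.integral_dX (hu : SmoothApprox u U) (hv : SmoothApprox v V)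
    (hf : IsFunction f F) (hm : IsMeasure (dX f) m) (hh : 0 ≤ h) :
    ∫ z, F z * (MixedTV.bdiff h U z.1 * V z.2)
      = -pairing m fun z => MixedTV.window h U z.1 * V z.2 := by
  refine tendsto_nhds_unique ((hu.bdiff h).tendsto_isFunction hv hf) ?_
  refine ((hu.window hh).tendsto_isMeasure hv hm).neg.congr fun j => ?_
  rw [dX_apply, hu.lineDerivOp_window_fst hv hh, neg_neg]

lemma SmoothApprox.integral_dY (hu : SmoothApprox u U) (hv : SmoothApprox v V)
    (hf : IsFunction f F) (hm : IsMeasure (dY f) m) (hh : 0 ≤ h) :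
    ∫ z, F z * (U z.1 * MixedTV.bdiff h V z.2)
      = -pairing m fun z => U z.1 * MixedTV.window h V z.2 := by
  refine tendsto_nhds_unique (hu.tendsto_isFunction (hv.bdiff h) hf) ?_
  refine (hu.tendsto_isMeasure (hv.window hh) hm).neg.congr fun j => ?_
  rw [dY_apply, hu.lineDerivOp_window_snd hv hh, neg_neg]

end Tensor

section Cells

/-- The indicator of the cell `[(k - 1) h, k h)`. -/
def ind (h : ℝ) (k : ℕ) : ℝ → ℝ := (Set.Ico (((k : ℝ) - 1) * h) (k * h)).indicator 1

lemma ind_nonneg (h : ℝ) (k : ℕ) (x : ℝ) : 0 ≤ ind h k x :=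
  Set.indicator_nonneg (fun _ _ => zero_le_one) x

lemma measurable_ind (h : ℝ) (k : ℕ) : Measurable (ind h k) :=
  measurable_one.indicator measurableSet_Ico

lemma ind_succ (h : ℝ) (k : ℕ) :
    ind h (k + 1) = (Set.Ico (k * h) (((k + 1 : ℕ) : ℝ) * h)).indicator 1 := by
  rw [ind, Nat.cast_succ, add_sub_cancel_right]

lemma bdiff_ind (h : ℝ) (k : ℕ) (x : ℝ) : bdiff h (ind h k) x = ind h k x - ind h (k + 1) x := by
  rw [bdiff, ind_succ]
  congr 1
  simp only [ind, Set.indicator, Set.mem_Ico, Nat.cast_succ]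
  refine if_congr ?_ rfl rfl
  constructor <;> rintro ⟨h1, h2⟩ <;> constructor <;> nlinarith

lemma exists_smoothApprox_ind (h : ℝ) (k : ℕ) :
    ∃ u, SmoothApprox u (ind h k) ∧ ∀ j x, 0 ≤ u j x :=
  exists_smoothApprox_indicator_Ico _ _

lemma ind_mul_ind_of_ne {h : ℝ} (hh : 0 ≤ h) {k l : ℕ} (hkl : k ≠ l) (x : ℝ) :
    ind h k x * ind h l x = 0 := by
  wlog H : k < l generalizing k l
  · rw [mul_comm]
    exact this hkl.symm (lt_of_le_of_ne (not_lt.1 H) hkl.symm)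
  by_cases hx : x < k * h
  · have hl : (k : ℝ) + 1 ≤ l := by exact_mod_cast H
    rw [show ind h l x = 0 from Set.indicator_of_notMem (fun hm => ?_) _, mul_zero]
    have := mul_le_mul_of_nonneg_right (show (k : ℝ) ≤ l - 1 by linarith) hh
    linarith [hm.1]
  · rw [show ind h k x = 0 from Set.indicator_of_notMem (fun hm => hx hm.2) _, zero_mul]

lemma ind_mul_self (h : ℝ) (k : ℕ) (x : ℝ) : ind h k x * ind h k x = ind h k x := by
  simp only [ind, Set.indicator]
  split_ifs <;> simp

lemma sum_ind_le_one {h : ℝ} (hh : 0 ≤ h) (s : Finset ℕ) (x : ℝ) : ∑ k ∈ s, ind h k x ≤ 1 := by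
  by_cases H : ∃ k ∈ s, ind h k x ≠ 0
  · obtain ⟨k, hk, hne⟩ := H
    have h1 : ind h k x = 1 := mul_left_cancel₀ hne ((ind_mul_self h k x).trans (mul_one _).symm)
    rw [Finset.sum_eq_single k (fun l _ hl => ?_) (fun h => absurd hk h), h1]
    exact (mul_eq_zero.1 (ind_mul_ind_of_ne hh hl x)).resolve_right hne
  · push Not at H
    rw [Finset.sum_eq_zero H]
    exact zero_le_one

lemma sum_ind_Ico {h : ℝ} (hh : 0 ≤ h) {p q : ℕ} (hpq : p ≤ q) (x : ℝ) :
    ∑ k ∈ Finset.Ico p q, ind h (k + 1) x = (Set.Ico (p * h) (q * h)).indicator 1 x := by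
  induction q, hpq using Nat.le_induction with
  | base => simp
  | succ q hq ih =>
    have h1 : (p : ℝ) * h ≤ q * h := mul_le_mul_of_nonneg_right (by exact_mod_cast hq) hh
    have h2 : (q : ℝ) * h ≤ ((q + 1 : ℕ) : ℝ) * h :=
      mul_le_mul_of_nonneg_right (by exact_mod_cast Nat.le_succ q) hh
    rw [Finset.sum_Ico_succ_top hq, ih, ind_succ, ← Set.Ico_union_Ico_eq_Ico h1 h2,
      Set.indicator_union_of_disjoint]
    rw [Set.disjoint_left]
    exact fun y hy hy' => absurd hy.2 (not_lt.2 hy'.1)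

lemma window_ind_nonneg {h : ℝ} (hh : 0 ≤ h) (k : ℕ) (x : ℝ) : 0 ≤ window h (ind h k) x :=
  intervalIntegral.integral_nonneg hh fun _ _ => ind_nonneg _ _ _

lemma measurable_window_ind {h : ℝ} (hh : 0 ≤ h) (k : ℕ) : Measurable (window h (ind h k)) := by
  obtain ⟨u, hu, -⟩ := exists_smoothApprox_ind h k
  exact (hu.window hh).measurable

lemma sum_window_ind_le {h : ℝ} (hh : 0 ≤ h) (s : Finset ℕ) (x : ℝ) :
    ∑ k ∈ s, window h (ind h k) x ≤ h := by
  have hint : ∀ k ∈ s, IntervalIntegrable (fun t => ind h k (x + t • (-1))) volume 0 h :=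
    fun k _ => by
      rw [intervalIntegrable_iff]
      refine Measure.integrableOn_of_bounded (M := 1) measure_Ioc_lt_top.ne
        ((measurable_ind h k).comp (by fun_prop)).aestronglyMeasurable (ae_of_all _ fun t => ?_)
      rw [Real.norm_of_nonneg (ind_nonneg _ _ _)]
      simpa using sum_ind_le_one hh {k} (x + t • (-1))
  unfold window
  rw [← intervalIntegral.integral_finsetSum hint]
  calc ∫ t in (0 : ℝ)..h, ∑ k ∈ s, ind h k (x + t • (-1)) ≤ ∫ _ in (0 : ℝ)..h, (1 : ℝ) :=
        intervalIntegral.integral_mono_on hh (f := fun t => ∑ k ∈ s, ind h k (x + t • (-1)))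
          (by simpa only [← Finset.sum_fn] using IntervalIntegrable.sum _ hint)
          intervalIntegrable_const fun t _ => by
            simpa using sum_ind_le_one hh s (x + t • (-1))
    _ = h := by simp

/-- The integral of `F` over the product of two cells. -/
def cellInt (F : ℝ × ℝ → ℝ) (h : ℝ) (k l : ℕ) : ℝ := ∫ z, F z * (ind h k z.1 * ind h l z.2)

/-- The product of two cells. -/
def cellProd (h : ℝ) (k l : ℕ) : Set (ℝ × ℝ) :=
  Set.Ico (((k : ℝ) - 1) * h) (k * h) ×ˢ Set.Ico (((l : ℝ) - 1) * h) (l * h)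

lemma measurableSet_cellProd (h : ℝ) (k l : ℕ) : MeasurableSet (cellProd h k l) :=
  measurableSet_Ico.prod measurableSet_Ico

lemma mul_ind_eq_indicator (F : ℝ × ℝ → ℝ) (h : ℝ) (k l : ℕ) :
    (fun z => F z * (ind h k z.1 * ind h l z.2)) = (cellProd h k l).indicator F := by
  ext z
  simp only [ind, Set.indicator, cellProd, Set.mem_prod]
  split_ifs <;> simp_all

lemma cellInt_eq_setIntegral (F : ℝ × ℝ → ℝ) (h : ℝ) (k l : ℕ) :
    cellInt F h k l = ∫ z in cellProd h k l, F z := by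
  rw [cellInt, mul_ind_eq_indicator, integral_indicator (measurableSet_cellProd h k l)]

lemma integrable_mul_ind {F : ℝ × ℝ → ℝ} (hF : LocallyIntegrable F volume) (h : ℝ) (k l : ℕ) :
    Integrable fun z => F z * (ind h k z.1 * ind h l z.2) := by
  rw [mul_ind_eq_indicator, integrable_indicator_iff (measurableSet_cellProd h k l)]
  exact (hF.integrableOn_isCompact (isCompact_Icc.prod isCompact_Icc)).mono_set
    (Set.prod_mono Set.Ico_subset_Icc_self Set.Ico_subset_Icc_self)

variable {f : Dist} {F : ℝ × ℝ → ℝ} {m : SignedMeasure (ℝ × ℝ)} {h : ℝ}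

lemma cellInt_nonneg (hf : IsFunction f F) (hpos : ∀ φ : Test, (∀ x, 0 ≤ φ x) → 0 ≤ f φ)
    (h : ℝ) (k l : ℕ) : 0 ≤ cellInt F h k l := by
  obtain ⟨u, hu, hu0⟩ := exists_smoothApprox_ind h k
  obtain ⟨v, hv, hv0⟩ := exists_smoothApprox_ind h l
  exact ge_of_tendsto' (hu.tendsto_isFunction hv hf) fun j =>
    hpos _ fun z => mul_nonneg (hu0 j z.1) (hv0 j z.2)

lemma cellInt_dX (hf : IsFunction f F) (hm : IsMeasure (dX f) m) (hh : 0 ≤ h) (k l : ℕ) :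
    cellInt F h (k + 1) l - cellInt F h k l
      = pairing m fun z => window h (ind h k) z.1 * ind h l z.2 := by
  obtain ⟨u, hu, -⟩ := exists_smoothApprox_ind h k
  obtain ⟨v, hv, -⟩ := exists_smoothApprox_ind h l
  have key := hu.integral_dX hv hf hm hh
  have e : ∀ z : ℝ × ℝ, F z * (bdiff h (ind h k) z.1 * ind h l z.2)
      = F z * (ind h k z.1 * ind h l z.2) - F z * (ind h (k + 1) z.1 * ind h l z.2) :=
    fun z => by rw [bdiff_ind]; ring
  simp only [e] at key
  rw [integral_sub (integrable_mul_ind hf.1 _ _ _) (integrable_mul_ind hf.1 _ _ _)] at key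
  simp only [cellInt]
  linarith

lemma cellInt_dY (hf : IsFunction f F) (hm : IsMeasure (dY f) m) (hh : 0 ≤ h) (k l : ℕ) :
    cellInt F h k (l + 1) - cellInt F h k l
      = pairing m fun z => ind h k z.1 * window h (ind h l) z.2 := by
  obtain ⟨u, hu, -⟩ := exists_smoothApprox_ind h k
  obtain ⟨v, hv, -⟩ := exists_smoothApprox_ind h l
  have key := hu.integral_dY hv hf hm hh
  have e : ∀ z : ℝ × ℝ, F z * (ind h k z.1 * bdiff h (ind h l) z.2)
      = F z * (ind h k z.1 * ind h l z.2) - F z * (ind h k z.1 * ind h (l + 1) z.2) :=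
    fun z => by rw [bdiff_ind]; ring
  simp only [e] at key
  rw [integral_sub (integrable_mul_ind hf.1 _ _ _) (integrable_mul_ind hf.1 _ _ _)] at key
  simp only [cellInt]
  linarith

lemma cellInt_dXY (hf : IsFunction f F) (hm : IsMeasure (dXY f) m) (hh : 0 ≤ h) (k l : ℕ) :
    (cellInt F h (k + 1) (l + 1) - cellInt F h k (l + 1))
        - (cellInt F h (k + 1) l - cellInt F h k l)
      = pairing m fun z => window h (ind h k) z.1 * window h (ind h l) z.2 := by
  obtain ⟨u, hu, -⟩ := exists_smoothApprox_ind h k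
  obtain ⟨v, hv, -⟩ := exists_smoothApprox_ind h l
  have key := hu.integral_dXY hv hf hm hh
  have e : ∀ z : ℝ × ℝ, F z * (bdiff h (ind h k) z.1 * bdiff h (ind h l) z.2)
      = (F z * (ind h k z.1 * ind h l z.2) - F z * (ind h (k + 1) z.1 * ind h l z.2))
        - (F z * (ind h k z.1 * ind h (l + 1) z.2)
          - F z * (ind h (k + 1) z.1 * ind h (l + 1) z.2)) :=
    fun z => by rw [bdiff_ind, bdiff_ind]; ring
  have hi := fun k l => integrable_mul_ind hf.1 h k l
  simp only [e] at key
  have hs : ∀ k l k' l', Integrable fun z : ℝ × ℝ =>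
      F z * (ind h k z.1 * ind h l z.2) - F z * (ind h k' z.1 * ind h l' z.2) :=
    fun k l k' l' => (hi k l).sub (hi k' l')
  rw [integral_sub (hs _ _ _ _) (hs _ _ _ _), integral_sub (hi _ _) (hi _ _),
    integral_sub (hi _ _) (hi _ _)] at key
  simp only [cellInt]
  linarith

lemma isClosed_unitSquare : IsClosed unitSquare := isClosed_Icc.prod isClosed_Icc

lemma ae_eq_zero_of_notMem (hf : IsFunction f F)
    (hoff : ∀ φ : Test, tsupport φ ⊆ unitSquareᶜ → f φ = 0) :
    ∀ᵐ z, z ∈ unitSquareᶜ → F z = 0 := by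
  refine isClosed_unitSquare.isOpen_compl.ae_eq_zero_of_integral_contDiff_smul_eq_zero
    (hf.1.locallyIntegrableOn _) fun g hg hc hs => ?_
  have := hf.2 (mkTest g hg hc)
  rw [hoff _ hs] at this
  rw [this]
  refine integral_congr_ae (ae_of_all _ fun z => ?_)
  simp [mul_comm]

lemma cellInt_eq_zero (hf : IsFunction f F)
    (hoff : ∀ φ : Test, tsupport φ ⊆ unitSquareᶜ → f φ = 0) {h : ℝ} {M : ℕ}
    (hM : M * h = 1) {k l : ℕ} (hkl : (k = 0 ∨ k = M + 1) ∨ l = 0 ∨ l = M + 1) :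
    cellInt F h k l = 0 := by
  have out : ∀ {k : ℕ} {x : ℝ}, (k = 0 ∨ k = M + 1) → x ≠ 1 →
      x ∈ Set.Ico (((k : ℝ) - 1) * h) (k * h) → x ∉ Set.Icc (0 : ℝ) 1 := by
    rintro k x (rfl | rfl) h1 hx hI
    · have := hx.2
      rw [Nat.cast_zero, zero_mul] at this
      linarith [hI.1]
    · have := hx.1
      rw [Nat.cast_succ, add_sub_cancel_right, hM] at this
      exact h1 (le_antisymm hI.2 this)
  have n1 : ∀ᵐ z : ℝ × ℝ, z.1 ≠ 1 :=
    Measure.quasiMeasurePreserving_fst.ae (Measure.ae_ne volume (1 : ℝ))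
  have n2 : ∀ᵐ z : ℝ × ℝ, z.2 ≠ 1 :=
    Measure.quasiMeasurePreserving_snd.ae (Measure.ae_ne volume (1 : ℝ))
  rw [cellInt_eq_setIntegral]
  refine setIntegral_eq_zero_of_ae_eq_zero ?_
  filter_upwards [n1, n2, ae_eq_zero_of_notMem hf hoff] with z h1 h2 hz hmem
  refine hz fun hK => ?_
  rcases hkl with h | h
  · exact out h h1 hmem.1 hK.1
  · exact out h h2 hmem.2 hK.2

end Cells

section CellIntegralsOfDerivatives

lemma hasDerivAt_test_fst (φ : Test) (x y : ℝ) :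
    HasDerivAt (fun x => φ (x, y)) ((∂_{((1, 0) : ℝ × ℝ)} φ) (x, y)) x := by
  have hd : DifferentiableAt ℝ φ (x, y) := (φ.contDiff.differentiable (by simp)).differentiableAt
  rw [lineDerivOp_test_apply, hd.lineDeriv_eq_fderiv]
  exact hd.hasFDerivAt.comp_hasDerivAt x ((hasDerivAt_id x).prodMk (hasDerivAt_const x y))

lemma hasDerivAt_test_snd (φ : Test) (x y : ℝ) :
    HasDerivAt (fun y => φ (x, y)) ((∂_{((0, 1) : ℝ × ℝ)} φ) (x, y)) y := by
  have hd : DifferentiableAt ℝ φ (x, y) := (φ.contDiff.differentiable (by simp)).differentiableAt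
  rw [lineDerivOp_test_apply, hd.lineDeriv_eq_fderiv]
  exact hd.hasFDerivAt.comp_hasDerivAt y ((hasDerivAt_const y x).prodMk (hasDerivAt_id y))

lemma intervalIntegral_deriv_fst (φ : Test) (a b y : ℝ) :
    ∫ x in a..b, (∂_{((1, 0) : ℝ × ℝ)} φ) (x, y) = φ (b, y) - φ (a, y) := by
  refine intervalIntegral.integral_eq_sub_of_hasDerivAt (f := fun x => φ (x, y))
    (fun x _ => hasDerivAt_test_fst φ x y) (Continuous.intervalIntegrable ?_ _ _)
  exact (∂_{((1, 0) : ℝ × ℝ)} φ).continuous.comp (by fun_prop)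

lemma intervalIntegral_deriv_snd (φ : Test) (a b x : ℝ) :
    ∫ y in a..b, (∂_{((0, 1) : ℝ × ℝ)} φ) (x, y) = φ (x, b) - φ (x, a) := by
  refine intervalIntegral.integral_eq_sub_of_hasDerivAt (f := fun y => φ (x, y))
    (fun y _ => hasDerivAt_test_snd φ x y) (Continuous.intervalIntegrable ?_ _ _)
  exact (∂_{((0, 1) : ℝ × ℝ)} φ).continuous.comp (by fun_prop)

/-- The integral of `φ` over the `l`-th vertical side on the line `x = k h`. -/
def vSide (φ : ℝ × ℝ → ℝ) (h : ℝ) (k l : ℕ) : ℝ :=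
  ∫ y in (l * h)..(((l + 1 : ℕ) : ℝ) * h), φ (k * h, y)

/-- The integral of `φ` over the `k`-th horizontal side on the line `y = l h`. -/
def hSide (φ : ℝ × ℝ → ℝ) (h : ℝ) (k l : ℕ) : ℝ :=
  ∫ x in (k * h)..(((k + 1 : ℕ) : ℝ) * h), φ (x, l * h)

lemma node_le_succ {h : ℝ} (hh : 0 ≤ h) (k : ℕ) : (k : ℝ) * h ≤ ((k + 1 : ℕ) : ℝ) * h :=
  mul_le_mul_of_nonneg_right (by exact_mod_cast Nat.le_succ k) hh

lemma cellProd_succ (h : ℝ) (k l : ℕ) : cellProd h (k + 1) (l + 1)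
    = Set.Ico (k * h) (((k + 1 : ℕ) : ℝ) * h) ×ˢ Set.Ico (l * h) (((l + 1 : ℕ) : ℝ) * h) := by
  rw [cellProd, Nat.cast_succ, Nat.cast_succ, add_sub_cancel_right, add_sub_cancel_right]

lemma cellInt_test (φ : Test) {h : ℝ} (hh : 0 ≤ h) (k l : ℕ) :
    cellInt φ h (k + 1) (l + 1) = ∫ x in (k * h)..(((k + 1 : ℕ) : ℝ) * h),
      ∫ y in (l * h)..(((l + 1 : ℕ) : ℝ) * h), φ (x, y) := by
  rw [cellInt_eq_setIntegral, cellProd_succ, Measure.volume_eq_prod,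
    setIntegral_prod _ (integrable_test φ _).integrableOn, integral_Ico_eq_integral_Ioc,
    intervalIntegral.integral_of_le (node_le_succ hh k)]
  simp only [integral_Ico_eq_integral_Ioc, intervalIntegral.integral_of_le (node_le_succ hh l)]

lemma cellInt_test_swap (φ : Test) {h : ℝ} (hh : 0 ≤ h) (k l : ℕ) :
    cellInt φ h (k + 1) (l + 1) = ∫ y in (l * h)..(((l + 1 : ℕ) : ℝ) * h),
      ∫ x in (k * h)..(((k + 1 : ℕ) : ℝ) * h), φ (x, y) := by
  rw [cellInt_test φ hh]
  exact intervalIntegral_intervalIntegral_swap (F := fun x y => φ (x, y))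
    (integrable_test φ _).integrableOn

lemma continuous_test_fst (φ : Test) (y : ℝ) : Continuous fun x => φ (x, y) :=
  φ.continuous.comp (by fun_prop)

lemma continuous_test_snd (φ : Test) (x : ℝ) : Continuous fun y => φ (x, y) :=
  φ.continuous.comp (by fun_prop)

lemma cellInt_deriv_fst (φ : Test) {h : ℝ} (hh : 0 ≤ h) (k l : ℕ) :
    cellInt (∂_{((1, 0) : ℝ × ℝ)} φ : Test) h (k + 1) (l + 1)
      = vSide φ h (k + 1) l - vSide φ h k l := by
  rw [cellInt_test_swap _ hh]
  simp only [intervalIntegral_deriv_fst]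
  exact intervalIntegral.integral_sub ((continuous_test_snd φ _).intervalIntegrable _ _)
    ((continuous_test_snd φ _).intervalIntegrable _ _)

lemma cellInt_deriv_snd (φ : Test) {h : ℝ} (hh : 0 ≤ h) (k l : ℕ) :
    cellInt (∂_{((0, 1) : ℝ × ℝ)} φ : Test) h (k + 1) (l + 1)
      = hSide φ h k (l + 1) - hSide φ h k l := by
  rw [cellInt_test _ hh]
  simp only [intervalIntegral_deriv_snd]
  exact intervalIntegral.integral_sub ((continuous_test_fst φ _).intervalIntegrable _ _)
    ((continuous_test_fst φ _).intervalIntegrable _ _)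

lemma hSide_deriv_fst (φ : Test) (h : ℝ) (k l : ℕ) :
    hSide (∂_{((1, 0) : ℝ × ℝ)} φ : Test) h k l
      = φ (((k + 1 : ℕ) : ℝ) * h, l * h) - φ (k * h, l * h) :=
  intervalIntegral_deriv_fst φ _ _ _

/-- Summation by parts for sequences that vanish at both ends. -/
lemma sum_by_parts (M : ℕ) (b A : ℕ → ℝ) (h0 : b 0 = 0) (hM : b (M + 1) = 0) :
    ∑ k ∈ Finset.range M, b (k + 1) * (A (k + 1) - A k)
      = -∑ k ∈ Finset.range (M + 1), (b (k + 1) - b k) * A k := by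
  have key : ∀ n, ∑ k ∈ Finset.range n, b (k + 1) * (A (k + 1) - A k)
      + ∑ k ∈ Finset.range (n + 1), (b (k + 1) - b k) * A k = b (n + 1) * A n - b 0 * A 0 := by
    intro n
    induction n with
    | zero => simp [sub_mul]
    | succ n ih =>
      rw [Finset.sum_range_succ, Finset.sum_range_succ _ (n + 1)]
      linarith
  have := key M
  rw [h0, hM] at this
  linarith

end CellIntegralsOfDerivatives

section CellAverage

/-- The function that is constant on the cells, with the averages of `F` as its values. -/
def cellAvg (F : ℝ × ℝ → ℝ) (h : ℝ) (M : ℕ) (z : ℝ × ℝ) : ℝ :=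
  ∑ k ∈ Finset.range M, ∑ l ∈ Finset.range M,
    cellInt F h (k + 1) (l + 1) / h ^ 2 * (ind h (k + 1) z.1 * ind h (l + 1) z.2)

lemma integrable_ind_mul_ind (h : ℝ) (k l : ℕ) :
    Integrable fun z : ℝ × ℝ => ind h k z.1 * ind h l z.2 := by
  simpa using integrable_mul_ind (locallyIntegrable_const (1 : ℝ)) h k l

lemma integrable_cellAvg (F : ℝ × ℝ → ℝ) (h : ℝ) (M : ℕ) : Integrable (cellAvg F h M) :=
  integrable_finsetSum _ fun _ _ => integrable_finsetSum _ fun _ _ =>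
    (integrable_ind_mul_ind _ _ _).const_mul _

lemma integral_cellAvg_mul (F : ℝ × ℝ → ℝ) (h : ℝ) (M : ℕ) {ψ : ℝ × ℝ → ℝ}
    (hψ : LocallyIntegrable ψ volume) :
    ∫ z, cellAvg F h M z * ψ z = ∑ k ∈ Finset.range M, ∑ l ∈ Finset.range M,
      cellInt F h (k + 1) (l + 1) / h ^ 2 * cellInt ψ h (k + 1) (l + 1) := by
  have e : ∀ z, cellAvg F h M z * ψ z = ∑ k ∈ Finset.range M, ∑ l ∈ Finset.range M,
      cellInt F h (k + 1) (l + 1) / h ^ 2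
        * (ψ z * (ind h (k + 1) z.1 * ind h (l + 1) z.2)) := fun z => by
    simp only [cellAvg, Finset.sum_mul]
    refine Finset.sum_congr rfl fun k _ => Finset.sum_congr rfl fun l _ => ?_
    ring
  have hi := fun k l => integrable_mul_ind hψ h (k + 1) (l + 1)
  simp only [e]
  rw [integral_finsetSum _ fun k _ => integrable_finsetSum _ fun l _ => (hi k l).const_mul _]
  refine Finset.sum_congr rfl fun k _ => ?_
  rw [integral_finsetSum _ fun l _ => (hi k l).const_mul _]
  refine Finset.sum_congr rfl fun l _ => ?_
  exact integral_const_mul _ _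

/-- The distribution given by a locally integrable function. -/
def ofFun (G : ℝ × ℝ → ℝ) : Dist :=
  TestFunction.integralAgainstBilinCLM (ContinuousLinearMap.mul ℝ ℝ) volume G

lemma isFunction_ofFun {G : ℝ × ℝ → ℝ} (hG : LocallyIntegrable G volume) :
    IsFunction (ofFun G) G := by
  refine ⟨hG, fun φ => ?_⟩
  refine (TestFunction.integralAgainstBilinCLM_eq_integral (hG.locallyIntegrableOn _)).trans ?_
  simp [mul_comm]

variable {F : ℝ × ℝ → ℝ} {h : ℝ} {M : ℕ}

lemma isFunction_cellAvg (F : ℝ × ℝ → ℝ) (h : ℝ) (M : ℕ) :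
    IsFunction (ofFun (cellAvg F h M)) (cellAvg F h M) :=
  isFunction_ofFun (integrable_cellAvg F h M).locallyIntegrable

lemma ofFun_cellAvg_apply (F : ℝ × ℝ → ℝ) (h : ℝ) (M : ℕ) (φ : Test) :
    ofFun (cellAvg F h M) φ = ∑ k ∈ Finset.range M, ∑ l ∈ Finset.range M,
      cellInt F h (k + 1) (l + 1) / h ^ 2 * cellInt φ h (k + 1) (l + 1) := by
  rw [(isFunction_cellAvg F h M).2, integral_cellAvg_mul F h M φ.continuous.locallyIntegrable]

lemma dX_cellAvg (hh : 0 ≤ h)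
    (hb : ∀ k l, (k = 0 ∨ k = M + 1) ∨ l = 0 ∨ l = M + 1 → cellInt F h k l = 0) (φ : Test) :
    dX (ofFun (cellAvg F h M)) φ = ∑ p ∈ Finset.range (M + 1) ×ˢ Finset.range M,
      (cellInt F h (p.1 + 1) (p.2 + 1) - cellInt F h p.1 (p.2 + 1)) / h ^ 2
        * vSide φ h p.1 p.2 := by
  rw [dX_apply, ofFun_cellAvg_apply, Finset.sum_comm, Finset.sum_product_right,
    ← Finset.sum_neg_distrib]
  refine Finset.sum_congr rfl fun l _ => ?_
  simp only [cellInt_deriv_fst φ hh, sub_div]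
  rw [sum_by_parts M (fun k => cellInt F h k (l + 1) / h ^ 2) (fun k => vSide φ h k l)
    (by simp [hb]) (by simp [hb]), neg_neg]

lemma dY_cellAvg (hh : 0 ≤ h)
    (hb : ∀ k l, (k = 0 ∨ k = M + 1) ∨ l = 0 ∨ l = M + 1 → cellInt F h k l = 0) (φ : Test) :
    dY (ofFun (cellAvg F h M)) φ = ∑ p ∈ Finset.range M ×ˢ Finset.range (M + 1),
      (cellInt F h (p.1 + 1) (p.2 + 1) - cellInt F h (p.1 + 1) p.2) / h ^ 2
        * hSide φ h p.1 p.2 := by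
  rw [dY_apply, ofFun_cellAvg_apply, Finset.sum_product, ← Finset.sum_neg_distrib]
  refine Finset.sum_congr rfl fun k _ => ?_
  simp only [cellInt_deriv_snd φ hh, sub_div]
  rw [sum_by_parts M (fun l => cellInt F h (k + 1) l / h ^ 2) (fun l => hSide φ h k l)
    (by simp [hb]) (by simp [hb]), neg_neg]

lemma dXY_cellAvg (hh : 0 ≤ h)
    (hb : ∀ k l, (k = 0 ∨ k = M + 1) ∨ l = 0 ∨ l = M + 1 → cellInt F h k l = 0) (φ : Test) :
    dXY (ofFun (cellAvg F h M)) φ = ∑ p ∈ Finset.range (M + 1) ×ˢ Finset.range (M + 1),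
      ((cellInt F h (p.1 + 1) (p.2 + 1) - cellInt F h p.1 (p.2 + 1))
        - (cellInt F h (p.1 + 1) p.2 - cellInt F h p.1 p.2)) / h ^ 2
        * φ (p.1 * h, p.2 * h) := by
  rw [dXY, dX_apply, dY_cellAvg hh hb, Finset.sum_product_right, Finset.sum_product_right,
    ← Finset.sum_neg_distrib]
  refine Finset.sum_congr rfl fun l _ => ?_
  simp only [hSide_deriv_fst]
  rw [sum_by_parts M (fun k => (cellInt F h k (l + 1) - cellInt F h k l) / h ^ 2)
    (fun k => φ (k * h, l * h)) (by simp [hb]) (by simp [hb]), neg_neg]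
  refine Finset.sum_congr rfl fun k _ => ?_
  ring

lemma cellAvg_nonneg (hF : ∀ k l, 0 ≤ cellInt F h k l) (z : ℝ × ℝ) : 0 ≤ cellAvg F h M z :=
  Finset.sum_nonneg fun _ _ => Finset.sum_nonneg fun _ _ =>
    mul_nonneg (div_nonneg (hF _ _) (sq_nonneg h))
      (mul_nonneg (ind_nonneg _ _ _) (ind_nonneg _ _ _))

lemma mem_Icc_of_ind_ne_zero (hh : 0 ≤ h) (hM : M * h = 1) {k : ℕ} (hk : k < M) {x : ℝ}
    (hx : ind h (k + 1) x ≠ 0) : x ∈ Set.Icc (0 : ℝ) 1 := by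
  rw [ind_succ] at hx
  have hm := Set.mem_of_indicator_ne_zero hx
  have h1 : ((k + 1 : ℕ) : ℝ) * h ≤ M * h := mul_le_mul_of_nonneg_right (by exact_mod_cast hk) hh
  exact ⟨(by positivity : (0 : ℝ) ≤ k * h).trans hm.1, by linarith [hm.2]⟩

lemma cellAvg_eq_zero (hh : 0 ≤ h) (hM : M * h = 1) {z : ℝ × ℝ} (hz : z ∉ unitSquare) :
    cellAvg F h M z = 0 := by
  refine Finset.sum_eq_zero fun k hk => Finset.sum_eq_zero fun l hl => ?_
  by_contra hne
  have h1 := right_ne_zero_of_mul hne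
  exact hz ⟨mem_Icc_of_ind_ne_zero hh hM (Finset.mem_range.1 hk) (left_ne_zero_of_mul h1),
    mem_Icc_of_ind_ne_zero hh hM (Finset.mem_range.1 hl) (right_ne_zero_of_mul h1)⟩

lemma cellInt_ind (hh : 0 < h) (k l k' l' : ℕ) :
    cellInt (fun z => ind h (k + 1) z.1 * ind h (l + 1) z.2) h (k' + 1) (l' + 1)
      = if k = k' ∧ l = l' then h ^ 2 else 0 := by
  split_ifs with H
  · obtain ⟨rfl, rfl⟩ := H
    have e : (fun z : ℝ × ℝ => ind h (k + 1) z.1 * ind h (l + 1) z.2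
        * (ind h (k + 1) z.1 * ind h (l + 1) z.2))
        = fun z => (1 : ℝ) * (ind h (k + 1) z.1 * ind h (l + 1) z.2) := by
      ext z
      rw [mul_mul_mul_comm, ind_mul_self, ind_mul_self, one_mul]
    rw [cellInt, e, ← cellInt, cellInt_eq_setIntegral, cellProd_succ, setIntegral_const,
      measureReal_def, Measure.volume_eq_prod, Measure.prod_prod, Real.volume_Ico,
      Real.volume_Ico, ENNReal.toReal_mul, ENNReal.toReal_ofReal, ENNReal.toReal_ofReal,
      Nat.cast_succ, Nat.cast_succ, smul_eq_mul]
    · ring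
    · linarith [node_le_succ hh.le l]
    · linarith [node_le_succ hh.le k]
  · have e : (fun z : ℝ × ℝ => ind h (k + 1) z.1 * ind h (l + 1) z.2
        * (ind h (k' + 1) z.1 * ind h (l' + 1) z.2)) = fun _ => 0 := by
      ext z
      rw [mul_mul_mul_comm]
      by_cases hk : k = k'
      · rw [ind_mul_ind_of_ne hh.le (k := l + 1) (l := l' + 1) (by omega), mul_zero]
      · rw [ind_mul_ind_of_ne hh.le (k := k + 1) (l := k' + 1) (by omega), zero_mul]
    rw [cellInt, e, integral_zero]

lemma cellInt_cellAvg (hh : 0 < h) {k l : ℕ} (hk : k < M) (hl : l < M) :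
    cellInt (cellAvg F h M) h (k + 1) (l + 1) = cellInt F h (k + 1) (l + 1) := by
  have e := integral_cellAvg_mul F h M
    (integrable_ind_mul_ind h (k + 1) (l + 1)).locallyIntegrable
  rw [cellInt, e]
  simp only [cellInt_ind hh]
  rw [Finset.sum_eq_single k, Finset.sum_eq_single l]
  · simp only [and_self, if_true]
    field_simp
  · intro l' _ hne
    rw [if_neg (by tauto), mul_zero]
  · exact fun hn => absurd (Finset.mem_range.2 hl) hn
  · intro k' _ hne
    refine Finset.sum_eq_zero fun l' _ => ?_
    rw [if_neg (by tauto), mul_zero]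
  · exact fun hn => absurd (Finset.mem_range.2 hk) hn

end CellAverage

section Norms

/-- A distribution that is a finite combination of measures carried by `S` is a measure carried
by `S`, of total variation at most that of the combination. -/
lemma exists_isMeasure_of_sum {ι : Type*} {s : Finset ι} {c : ι → ℝ} {ρ : ι → Measure (ℝ × ℝ)}
    [∀ i, IsFiniteMeasure (ρ i)] {T : Dist} {S : Set (ℝ × ℝ)}
    (hT : ∀ φ : Test, T φ = ∑ i ∈ s, c i * ∫ z, φ z ∂(ρ i)) (hS : ∀ i ∈ s, ρ i Sᶜ = 0) :
    ∃ m, (IsMeasure T m ∧ CarriedBy m S) ∧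
      m.totalVariation Set.univ ≤ ∑ i ∈ s, ENNReal.ofReal |c i| * ρ i Set.univ := by
  obtain ⟨m, hm, htv⟩ := exists_signedMeasure_sum s c ρ
  refine ⟨m, ⟨fun φ => ?_, ?_⟩, htv _⟩
  · rw [hT, hm _ fun κ _ => integrable_test φ κ]
  · refine le_antisymm ((htv _).trans (le_of_eq ?_)) zero_le
    exact Finset.sum_eq_zero fun i hi => by rw [hS i hi, mul_zero]

lemma measureNorm_le_of_sum {ι : Type*} {s : Finset ι} {c : ι → ℝ} {ρ : ι → Measure (ℝ × ℝ)}
    [∀ i, IsFiniteMeasure (ρ i)] {T : Dist}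
    (hT : ∀ φ : Test, T φ = ∑ i ∈ s, c i * ∫ z, φ z ∂(ρ i)) (hS : ∀ i ∈ s, ρ i unitSquareᶜ = 0) :
    measureNorm T ≤ ∑ i ∈ s, ENNReal.ofReal |c i| * ρ i Set.univ := by
  obtain ⟨m, hm, htv⟩ := exists_isMeasure_of_sum hT hS
  exact (iInf₂_le m hm).trans htv

lemma sum_abs_pairing_le {a b : ℕ → ℝ → ℝ} (ha : ∀ k x, 0 ≤ a k x) (hb : ∀ l y, 0 ≤ b l y)
    (hma : ∀ k, Measurable (a k)) (hmb : ∀ l, Measurable (b l)) {s t : Finset ℕ} {C D : ℝ}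
    (hC : ∀ x, ∑ k ∈ s, a k x ≤ C) (hD : ∀ y, ∑ l ∈ t, b l y ≤ D)
    (m : SignedMeasure (ℝ × ℝ)) :
    ∑ p ∈ s ×ˢ t, ENNReal.ofReal |pairing m fun z => a p.1 z.1 * b p.2 z.2|
      ≤ ENNReal.ofReal (C * D) * m.totalVariation Set.univ := by
  have key := sum_abs_integral_sub_le (X := ℝ × ℝ) (ι := ℕ × ℕ) (s ×ˢ t)
    (fun p z => a p.1 z.1 * b p.2 z.2) m.toJordanDecomposition.posPart
    m.toJordanDecomposition.negPart (fun p z => mul_nonneg (ha _ _) (hb _ _))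
    (fun p => ((hma _).comp measurable_fst).mul ((hmb _).comp measurable_snd)) (C := C * D)
  refine key fun z => ?_
  rw [Finset.sum_product]
  simp only [← Finset.mul_sum, ← Finset.sum_mul]
  exact mul_le_mul (hC _) (hD _) (Finset.sum_nonneg fun _ _ => hb _ _)
    ((Finset.sum_nonneg fun _ _ => ha _ _).trans (hC z.1))

lemma sum_ind_succ_le_one {h : ℝ} (hh : 0 ≤ h) (M : ℕ) (x : ℝ) :
    ∑ k ∈ Finset.range M, ind h (k + 1) x ≤ 1 := by
  rw [Finset.range_eq_Ico, sum_ind_Ico hh (Nat.zero_le M)]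
  exact Set.indicator_apply_le' (fun _ => le_rfl) fun _ => zero_le_one

lemma sum_ofReal_abs_div_mul_le {ι : Type*} {s : Finset ι} {a : ι → ℝ} {A B C : ℝ} {τ : ℝ≥0∞}
    (hA : 0 < A) (hB : 0 ≤ B) (hAC : B * C = A)
    (hs : ∑ i ∈ s, ENNReal.ofReal |a i| ≤ ENNReal.ofReal C * τ) :
    ∑ i ∈ s, ENNReal.ofReal |a i / A| * ENNReal.ofReal B ≤ τ := by
  have e : ∀ i ∈ s, ENNReal.ofReal |a i / A| * ENNReal.ofReal B
      = ENNReal.ofReal (B / A) * ENNReal.ofReal |a i| := fun i _ => by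
    rw [← ENNReal.ofReal_mul (abs_nonneg _), ← ENNReal.ofReal_mul (by positivity), abs_div,
      abs_of_pos hA]
    congr 1
    ring
  rw [Finset.sum_congr rfl e, ← Finset.mul_sum]
  refine (mul_le_mul_right hs _).trans (le_of_eq ?_)
  rw [← mul_assoc, ← ENNReal.ofReal_mul (by positivity), div_mul_eq_mul_div, hAC,
    div_self hA.ne', ENNReal.ofReal_one, one_mul]

variable {f : Dist} {F : ℝ × ℝ → ℝ} {h : ℝ} {M : ℕ}

lemma node_mem_Icc (hh : 0 ≤ h) (hM : M * h = 1) {k : ℕ} (hk : k ≤ M) :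
    (k : ℝ) * h ∈ Set.Icc (0 : ℝ) 1 :=
  ⟨by positivity, hM ▸ mul_le_mul_of_nonneg_right (by exact_mod_cast hk) hh⟩

/-- Lebesgue measure on the `k`-th interval of length `h`. -/
def sideMeasure (h : ℝ) (k : ℕ) : Measure ℝ :=
  volume.restrict (Set.Ioc (k * h) (((k + 1 : ℕ) : ℝ) * h))

instance (h : ℝ) (k : ℕ) : IsFiniteMeasure (sideMeasure h k) := by
  unfold sideMeasure
  infer_instance

lemma sideMeasure_univ (h : ℝ) (k : ℕ) : sideMeasure h k Set.univ = ENNReal.ofReal h := by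
  rw [sideMeasure, Measure.restrict_apply_univ, Real.volume_Ioc, Nat.cast_succ]
  congr 1
  ring

lemma sideMeasure_Icc_compl (hh : 0 ≤ h) (hM : M * h = 1) {k : ℕ} (hk : k < M) :
    sideMeasure h k (Set.Icc 0 1)ᶜ = 0 := by
  rw [sideMeasure, Measure.restrict_apply measurableSet_Icc.compl]
  suffices H : (Set.Icc (0 : ℝ) 1)ᶜ ∩ Set.Ioc (k * h) (((k + 1 : ℕ) : ℝ) * h) = ∅ by
    rw [H, measure_empty]
  rw [Set.eq_empty_iff_forall_notMem]
  rintro x ⟨hx, h1, h2⟩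
  exact hx ⟨(node_mem_Icc hh hM hk.le).1.trans h1.le, h2.trans (node_mem_Icc hh hM hk).2⟩

lemma vSide_eq_integral (φ : Test) (hh : 0 ≤ h) (k l : ℕ) :
    vSide φ h k l = ∫ z, φ z ∂(sideMeasure h l).map fun y => ((k : ℝ) * h, y) := by
  rw [integral_map (by fun_prop) φ.continuous.aestronglyMeasurable, vSide,
    intervalIntegral.integral_of_le (node_le_succ hh l), sideMeasure]

lemma hSide_eq_integral (φ : Test) (hh : 0 ≤ h) (k l : ℕ) :
    hSide φ h k l = ∫ z, φ z ∂(sideMeasure h k).map fun x => (x, (l : ℝ) * h) := by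
  rw [integral_map (by fun_prop) φ.continuous.aestronglyMeasurable, hSide,
    intervalIntegral.integral_of_le (node_le_succ hh k), sideMeasure]

lemma measureNorm_dX_cellAvg_le (hf : IsFunction f F)
    (hoff : ∀ φ : Test, tsupport φ ⊆ unitSquareᶜ → f φ = 0) (hh : 0 < h) (hM : M * h = 1) :
    measureNorm (dX (ofFun (cellAvg F h M))) ≤ measureNorm (dX f) := by
  refine le_iInf₂ fun m hm => ?_
  have hT : ∀ φ : Test, dX (ofFun (cellAvg F h M)) φ
      = ∑ p ∈ Finset.range (M + 1) ×ˢ Finset.range M,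
      (cellInt F h (p.1 + 1) (p.2 + 1) - cellInt F h p.1 (p.2 + 1)) / h ^ 2
        * ∫ z, φ z ∂(sideMeasure h p.2).map fun y => ((p.1 : ℝ) * h, y) := fun φ => by
    simp only [← vSide_eq_integral φ hh.le]
    exact dX_cellAvg hh.le (fun k l hkl => cellInt_eq_zero hf hoff hM hkl) φ
  refine (measureNorm_le_of_sum hT fun p hp => ?_).trans ?_
  · rw [Finset.mem_product, Finset.mem_range, Finset.mem_range] at hp
    rw [Measure.map_apply (by fun_prop) isClosed_unitSquare.measurableSet.compl]
    refine measure_mono_null (t := (Set.Icc 0 1)ᶜ) (fun y hy hyI => hy ?_)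
      (sideMeasure_Icc_compl hh.le hM hp.2)
    exact ⟨node_mem_Icc hh.le hM (Nat.lt_succ_iff.1 hp.1), hyI⟩
  · simp only [Measure.map_apply (measurable_prodMk_left) MeasurableSet.univ, Set.preimage_univ,
      sideMeasure_univ, cellInt_dX hf hm.1 hh.le]
    refine sum_ofReal_abs_div_mul_le (C := h * 1) (by positivity) hh.le (by ring) ?_
    exact sum_abs_pairing_le (a := fun k => window h (ind h k)) (b := fun l => ind h (l + 1))
      (fun k => window_ind_nonneg hh.le k) (fun l => ind_nonneg h _)
      (fun k => measurable_window_ind hh.le k) (fun l => measurable_ind h _)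
      (sum_window_ind_le hh.le _) (sum_ind_succ_le_one hh.le M) m

lemma measureNorm_dY_cellAvg_le (hf : IsFunction f F)
    (hoff : ∀ φ : Test, tsupport φ ⊆ unitSquareᶜ → f φ = 0) (hh : 0 < h) (hM : M * h = 1) :
    measureNorm (dY (ofFun (cellAvg F h M))) ≤ measureNorm (dY f) := by
  refine le_iInf₂ fun m hm => ?_
  have hT : ∀ φ : Test, dY (ofFun (cellAvg F h M)) φ
      = ∑ p ∈ Finset.range M ×ˢ Finset.range (M + 1),
      (cellInt F h (p.1 + 1) (p.2 + 1) - cellInt F h (p.1 + 1) p.2) / h ^ 2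
        * ∫ z, φ z ∂(sideMeasure h p.1).map fun x => (x, (p.2 : ℝ) * h) := fun φ => by
    simp only [← hSide_eq_integral φ hh.le]
    exact dY_cellAvg hh.le (fun k l hkl => cellInt_eq_zero hf hoff hM hkl) φ
  refine (measureNorm_le_of_sum hT fun p hp => ?_).trans ?_
  · rw [Finset.mem_product, Finset.mem_range, Finset.mem_range] at hp
    rw [Measure.map_apply (by fun_prop) isClosed_unitSquare.measurableSet.compl]
    refine measure_mono_null (t := (Set.Icc 0 1)ᶜ) (fun y hy hyI => hy ?_)
      (sideMeasure_Icc_compl hh.le hM hp.1)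
    exact ⟨hyI, node_mem_Icc hh.le hM (Nat.lt_succ_iff.1 hp.2)⟩
  · simp only [Measure.map_apply (measurable_prodMk_right) MeasurableSet.univ, Set.preimage_univ,
      sideMeasure_univ, cellInt_dY hf hm.1 hh.le]
    refine sum_ofReal_abs_div_mul_le (C := 1 * h) (by positivity) hh.le (by ring) ?_
    exact sum_abs_pairing_le (a := fun k => ind h (k + 1)) (b := fun l => window h (ind h l))
      (fun k => ind_nonneg h _) (fun l => window_ind_nonneg hh.le l)
      (fun k => measurable_ind h _) (fun l => measurable_window_ind hh.le l)
      (sum_ind_succ_le_one hh.le M) (sum_window_ind_le hh.le _) m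

lemma dXY_cellAvg_eq_sum_dirac (hf : IsFunction f F)
    (hoff : ∀ φ : Test, tsupport φ ⊆ unitSquareᶜ → f φ = 0) (hh : 0 < h) (hM : M * h = 1)
    (φ : Test) :
    dXY (ofFun (cellAvg F h M)) φ = ∑ p ∈ Finset.range (M + 1) ×ˢ Finset.range (M + 1),
      ((cellInt F h (p.1 + 1) (p.2 + 1) - cellInt F h p.1 (p.2 + 1))
        - (cellInt F h (p.1 + 1) p.2 - cellInt F h p.1 p.2)) / h ^ 2
        * ∫ z, φ z ∂Measure.dirac ((p.1 : ℝ) * h, (p.2 : ℝ) * h) := by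
  simp only [integral_dirac]
  exact dXY_cellAvg hh.le (fun k l hkl => cellInt_eq_zero hf hoff hM hkl) φ

lemma measureNorm_dXY_cellAvg_le (hf : IsFunction f F)
    (hoff : ∀ φ : Test, tsupport φ ⊆ unitSquareᶜ → f φ = 0) (hh : 0 < h) (hM : M * h = 1) :
    measureNorm (dXY (ofFun (cellAvg F h M))) ≤ measureNorm (dXY f) := by
  refine le_iInf₂ fun m hm => ?_
  refine (measureNorm_le_of_sum (dXY_cellAvg_eq_sum_dirac hf hoff hh hM) fun p hp => ?_).trans ?_
  · rw [Finset.mem_product, Finset.mem_range, Finset.mem_range, Nat.lt_succ_iff,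
      Nat.lt_succ_iff] at hp
    rw [Measure.dirac_apply' _ isClosed_unitSquare.measurableSet.compl]
    refine Set.indicator_of_notMem (Set.notMem_compl_iff.2 ?_) _
    exact ⟨node_mem_Icc hh.le hM hp.1, node_mem_Icc hh.le hM hp.2⟩
  · simp only [measure_univ, cellInt_dXY hf hm.1 hh.le]
    rw [← ENNReal.ofReal_one]
    refine sum_ofReal_abs_div_mul_le (C := h * h) (by positivity) zero_le_one (by ring) ?_
    exact sum_abs_pairing_le (a := fun k => window h (ind h k)) (b := fun l => window h (ind h l))
      (fun k => window_ind_nonneg hh.le k) (fun l => window_ind_nonneg hh.le l)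
      (fun k => measurable_window_ind hh.le k) (fun l => measurable_window_ind hh.le l)
      (sum_window_ind_le hh.le _) (sum_window_ind_le hh.le _) m

end Norms

section Grid

lemma MemMeasures.mono {S S' : Set (ℝ × ℝ)} (hS : S ⊆ S') {T : Dist} (hT : MemMeasures S T) :
    MemMeasures S' T := by
  obtain ⟨m, hm, hc⟩ := hT
  exact ⟨m, hm, measure_mono_null (Set.compl_subset_compl.2 hS) hc⟩

lemma grid_subset_unitSquare (n : ℕ) : grid n ⊆ unitSquare := by
  rintro _ ⟨i, j, hi, hj, rfl⟩
  have h : ∀ {i : ℕ}, i ≤ 2 ^ n → (i : ℝ) / 2 ^ n ∈ Set.Icc (0 : ℝ) 1 := fun {i} hi =>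
    ⟨by positivity, div_le_one_of_le₀ (by exact_mod_cast hi) (by positivity)⟩
  exact ⟨h hi, h hj⟩

lemma grid_mono {n n' : ℕ} (hn : n ≤ n') : grid n ⊆ grid n' := by
  rintro _ ⟨i, j, hi, hj, rfl⟩
  obtain ⟨d, rfl⟩ := Nat.exists_eq_add_of_le hn
  have h : ∀ i : ℕ, (i : ℝ) / 2 ^ n = ((i * 2 ^ d : ℕ) : ℝ) / 2 ^ (n + d) := fun i => by
    rw [pow_add]
    push_cast
    field_simp
  refine ⟨i * 2 ^ d, j * 2 ^ d, ?_, ?_, by rw [h i, h j]⟩ <;> rw [pow_add] <;>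
    exact Nat.mul_le_mul_right _ ‹_›

lemma gridCone_mono {n n' : ℕ} (hn : n ≤ n') : gridCone n ⊆ gridCone n' :=
  fun _ hf => ⟨hf.1, hf.2.mono (grid_mono hn)⟩

lemma ae_eq_of_isFunction {f : Dist} {F G : ℝ × ℝ → ℝ} (hF : IsFunction f F)
    (hG : IsFunction f G) : F =ᵐ[volume] G := by
  refine ae_eq_of_integral_contDiff_smul_eq hF.1 hG.1 fun g hg hc => ?_
  have h : ∫ z, F z * g z = ∫ z, G z * g z :=
    (hF.2 (mkTest g hg hc)).symm.trans (hG.2 (mkTest g hg hc))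
  simpa only [smul_eq_mul, mul_comm] using h

lemma integralOver_eq {f : Dist} {F : ℝ × ℝ → ℝ} (hF : IsFunction f F) (E : Set (ℝ × ℝ)) :
    integralOver E f = ∫ z in E, F z := by
  have H : ∃ F, IsFunction f F := ⟨F, hF⟩
  rw [integralOver, dif_pos H]
  exact integral_congr_ae (ae_restrict_of_ae (ae_eq_of_isFunction H.choose_spec hF))

lemma setIntegral_Ico_prod_eq_sum {F : ℝ × ℝ → ℝ} (hF : LocallyIntegrable F volume) {h : ℝ}
    (hh : 0 ≤ h) {p q p' q' : ℕ} (hpq : p ≤ q) (hpq' : p' ≤ q') :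
    ∫ z in Set.Ico (p * h) (q * h) ×ˢ Set.Ico (p' * h) (q' * h), F z
      = ∑ k ∈ Finset.Ico p q, ∑ l ∈ Finset.Ico p' q', cellInt F h (k + 1) (l + 1) := by
  have hi := fun k l => integrable_mul_ind hF h (k + 1) (l + 1)
  rw [← integral_indicator (measurableSet_Ico.prod measurableSet_Ico)]
  simp only [cellInt]
  simp only [← integral_finsetSum _ fun l _ => hi _ l]
  rw [← integral_finsetSum _ fun k _ => integrable_finsetSum _ fun l _ => hi k l]
  refine integral_congr_ae (ae_of_all _ fun z => ?_)
  simp only [← Finset.mul_sum, ← Finset.sum_mul, sum_ind_Ico hh hpq, sum_ind_Ico hh hpq']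
  simp only [Set.indicator, Set.mem_prod]
  split_ifs <;> simp_all

lemma setIntegral_pixel {F : ℝ × ℝ → ℝ} (hF : LocallyIntegrable F volume) (N d : ℕ)
    (i j : Fin (2 ^ N)) :
    ∫ z in pixel N i j, F z
      = ∑ k ∈ Finset.Ico ((i : ℕ) * 2 ^ d) (((i : ℕ) + 1) * 2 ^ d),
        ∑ l ∈ Finset.Ico ((j : ℕ) * 2 ^ d) (((j : ℕ) + 1) * 2 ^ d),
          cellInt F (1 / 2 ^ (N + d)) (k + 1) (l + 1) := by
  have e : ∀ a : ℕ, (a : ℝ) / 2 ^ N = ((a * 2 ^ d : ℕ) : ℝ) * (1 / 2 ^ (N + d)) := fun a => by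
    rw [pow_add]
    push_cast
    field_simp
  have e' : ∀ a : ℕ, ((a : ℝ) + 1) / 2 ^ N
      = (((a + 1) * 2 ^ d : ℕ) : ℝ) * (1 / 2 ^ (N + d)) := fun a => by
    rw [← e, Nat.cast_succ]
  rw [← setIntegral_Ico_prod_eq_sum hF (by positivity)
    (Nat.mul_le_mul_right _ (i : ℕ).le_succ) (Nat.mul_le_mul_right _ (j : ℕ).le_succ), pixel, e,
    e, e', e']
  exact setIntegral_congr_set (Measure.set_prod_ae_eq Ico_ae_eq_Icc Ico_ae_eq_Icc).symm

/-- Averaging over the dyadic cells does not change the integrals over coarser pixels. -/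
lemma measurement_cellAvg {f : Dist} {F : ℝ × ℝ → ℝ} (hf : IsFunction f F) (N d : ℕ) :
    measurement N (ofFun (cellAvg F (1 / 2 ^ (N + d)) (2 ^ (N + d)))) = measurement N f := by
  ext i j
  have lt : ∀ (i : Fin (2 ^ N)) {k : ℕ}, k ∈ Finset.Ico ((i : ℕ) * 2 ^ d) (((i : ℕ) + 1) * 2 ^ d) →
      k < 2 ^ (N + d) := fun i k hk => by
    refine (Finset.mem_Ico.1 hk).2.trans_le ?_
    rw [pow_add]
    exact Nat.mul_le_mul_right _ i.2
  rw [measurement, measurement, integralOver_eq hf, integralOver_eq (isFunction_cellAvg _ _ _),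
    setIntegral_pixel hf.1 N d, setIntegral_pixel (isFunction_cellAvg _ _ _).1 N d]
  refine Finset.sum_congr rfl fun k hk => Finset.sum_congr rfl fun l hl => ?_
  exact cellInt_cellAvg (by positivity) (lt i hk) (lt j hl)

/-- Averaging over the dyadic cells maps the cone to the cone of the grid. -/
lemma cellAvg_mem_gridCone {f : Dist} {F : ℝ × ℝ → ℝ} (hf : IsFunction f F)
    (hfc : f ∈ nativeCone) (n : ℕ) : ofFun (cellAvg F (1 / 2 ^ n) (2 ^ n)) ∈ gridCone n := by
  have hh : (0 : ℝ) < 1 / 2 ^ n := by positivity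
  have hM : ((2 ^ n : ℕ) : ℝ) * (1 / 2 ^ n) = 1 := by
    push_cast
    field_simp
  have hG := isFunction_cellAvg F (1 / 2 ^ n) (2 ^ n)
  have hgrid : MemMeasures (grid n) (dXY (ofFun (cellAvg F (1 / 2 ^ n) (2 ^ n)))) := by
    obtain ⟨m, hm, -⟩ := exists_isMeasure_of_sum (S := grid n)
      (dXY_cellAvg_eq_sum_dirac hf hfc.1.2 hh hM) fun p hp => by
        rw [Finset.mem_product, Finset.mem_range, Finset.mem_range, Nat.lt_succ_iff,
          Nat.lt_succ_iff] at hp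
        have hmem : ((p.1 : ℝ) * (1 / 2 ^ n), (p.2 : ℝ) * (1 / 2 ^ n)) ∈ grid n :=
          ⟨p.1, p.2, hp.1, hp.2, by rw [mul_one_div, mul_one_div]⟩
        rw [Measure.dirac_apply]
        exact Set.indicator_of_notMem (Set.notMem_compl_iff.2 hmem) _
    exact ⟨m, hm⟩
  refine ⟨⟨⟨hgrid.mono (grid_subset_unitSquare n), fun φ hφ => ?_⟩, fun φ hφ => ?_⟩, hgrid⟩
  · rw [hG.2]
    refine integral_eq_zero_of_ae (ae_of_all _ fun z => ?_)
    by_cases hz : z ∈ unitSquare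
    · simp [image_eq_zero_of_notMem_tsupport fun hn => hφ hn hz]
    · exact mul_eq_zero_of_left (cellAvg_eq_zero hh.le hM hz) _
  · rw [hG.2]
    exact integral_nonneg fun z => mul_nonneg
      (cellAvg_nonneg (fun k l => cellInt_nonneg hf hfc.2 _ k l) z) (hφ z)

theorem exists_mem_gridCone_loss_le {N n : ℕ} (hn : N ≤ n)
    (y : Matrix (Fin (2 ^ N)) (Fin (2 ^ N)) ℝ) (lam θ : ℝ) {f : Dist} (hf : f ∈ nativeCone) :
    ∃ g ∈ gridCone n, loss N y lam θ g ≤ loss N y lam θ f := by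
  obtain ⟨F, hF⟩ := exists_isFunction hf.1
  obtain ⟨d, rfl⟩ := Nat.exists_eq_add_of_le hn
  have hh : (0 : ℝ) < 1 / 2 ^ (N + d) := by positivity
  have hM : ((2 ^ (N + d) : ℕ) : ℝ) * (1 / 2 ^ (N + d)) = 1 := by
    push_cast
    field_simp
  refine ⟨_, cellAvg_mem_gridCone hF hf (N + d), ?_⟩
  rw [loss, loss, measurement_cellAvg hF, mixedNorm, mixedNorm]
  gcongr
  · exact measureNorm_dXY_cellAvg_le hF hf.1.2 hh hM
  · exact measureNorm_dY_cellAvg_le hF hf.1.2 hh hM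
  · exact measureNorm_dX_cellAvg_le hF hf.1.2 hh hM

end Grid

end

end MixedTV

theorem mainTheorem3 (N : ℕ) (y : Matrix (Fin (2 ^ N)) (Fin (2 ^ N)) ℝ) (lam θ : ℝ)
    (hlam : 0 ≤ lam) (hθ : 0 < θ) (hθ' : θ ≤ 1) (N₁ N₂ : ℕ) (h₁ : N ≤ N₁) (h₂ : N₁ ≤ N₂) :
    MixedTV.gridSolutions N y lam θ N₁ ⊆ MixedTV.gridSolutions N y lam θ N₂ ∧
      MixedTV.gridSolutions N y lam θ N₂ ⊆ MixedTV.solutions N y lam θ := by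
  refine ⟨fun f hf => ⟨MixedTV.gridCone_mono h₂ hf.1, fun g hg => ?_⟩,
    fun f hf => ⟨hf.1.1, fun g hg => ?_⟩⟩
  · obtain ⟨g', hg', hle⟩ := MixedTV.exists_mem_gridCone_loss_le h₁ y lam θ hg.1
    exact (hf.2 g' hg').trans hle
  · obtain ⟨g', hg', hle⟩ := MixedTV.exists_mem_gridCone_loss_le (h₁.trans h₂) y lam θ hg
    exact (hf.2 g' hg').trans hle
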